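/- **Setting.** *Terms* of the target calculus are $t,u ::= p \mid \pi_i t \mid \langle t_1,\dots,t_n\rangle \mid t\,u \mid [t\,|\,b]^{n,m}$ ($i\ge 1$, $n,m\ge 0$), where $p ::= \pi_i\mathtt l\mid\pi_i\mathtt s$ are the projected variables and $[t\,|\,b]^{n,m}$ is a closure with body $t$ and bag $b$. A term is *closed* if no projected variable occurs in it outside closure bodies. It is *prime* if in all its closures $[t\,|\,b]^{n,m}$ the bag is a tuple of exactly $n$ projected variables, and $i\le n$ (resp. $i\le m$) for every $\pi_i\mathtt l$ (resp. $\pi_i\mathtt s$) occurring in $t$ outside closure bodies. The *size* is $|p|=1$, $|\pi_i t|=|t|+1$, $|\langle t_1,\dots,t_n\rangle|=n+\sum_i|t_i|$, $|t\,u|=|t|+|u|+1$, $|[t\,|\,b]^{n,m}|=|t|+n+m$. The *Target TAM* has states $(\text{focus},S,E,A)$. The focus is a non-evaluated term $\circ t$ or an evaluated value $\bullet v$, that is, a tuple $\bullet\langle\vec v\rangle$ of evaluated values or an evaluated closure $\bullet[\circ t\,|\,\vec v]$. The constructor stack $S$ has entries $\circ t$, $\bullet v$, $\pi_i$ and $\langle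 \circ t_1,\dots,\circ t_h,\downarrow,\bullet v_1,\dots,\bullet v_j\rangle$; $E=\vec v_{\mathtt l};\vec v_{\mathtt s}$ is a pair of tuples of evaluated values, with look-up $E(\pi_i\mathtt l)=(\vec v_{\mathtt l})_i$ and $E(\pi_i\mathtt s)=(\vec v_{\mathtt s})_i$, undefined if $i$ is too large; $A$ is a stack of pairs $(S,E)$. The initial state of a closed prime term $t$ is $(\circ t,\epsilon,(\langle\rangle;\langle\rangle),\epsilon)$. Transitions (components that do not change are omitted): - $(\circ(tu),S)\to(\circ u,\ \circ t:S)$; - $(\circ\pi_it,S)\to(\circ t,\ \pi_i:S)$; - $(\circ\langle t_1,\dots,t_n\rangle,S)\to(\circ t_n,\ \langle\circ t_1,\dots,\circ t_{n-1},\downarrow\rangle:S)$ if $n\ge1$; - $\circ\langle\rangle\to\bullet\langle\rangle$; - $\circ[t\,|\,\vec p]\to\bullet[\circ t\,|\,E(\vec p)]$ and $\circ p\to E(p)$, if the look-ups are defined; - $(\bullet v,\ \circ t:S)\to(\circ t,\ \bullet v:S)$; - $(\bullet v,\ \langle\dots,\circ t,\downarrow,\dots\rangle:S)\to(\circ t,\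 \langle\dots,\downarrow,\bullet v,\dots\rangle:S)$; - $(\bullet v,\ \langle\downarrow,\vec w\rangle:S)\to(\bullet\langle v,\vec w\rangle,\ S)$; - $(\bullet\langle\vec v\rangle,\ \pi_i:S)\to(\bullet v_i,\ S)$ if $v_i$ exists; - ($\beta_v$) $(\bullet[\circ t\,|\,\vec v],\ \bullet\langle\vec w\rangle:S,\ E,\ A)\to(\circ t,\ \epsilon,\ \vec v;\vec w,\ (S,E):A)$; - $(\bullet v,\ \epsilon,\ E,\ (S,E'):A)\to(\bullet v,\ S,\ E',\ A)$. A run $\rho$ is a finite sequence of transitions, $|\rho|$ is its length and $|\rho|_{\beta_v}$ its number of $\beta_v$ transitions. It is *complete* if no transition applies to its last state. *RAMs* have registers and a memory holding natural numbers; their unit-cost instructions are constant, copy, addition, truncated subtraction, indirect load, indirect store, jump and jump-if-zero. Terms, values, stacks and environments are laid out in memory as fixed linked blocks: sub-objects are referred to by address and can be shared, tuples and bags are arrays. **Theorem.** There are a RAM program $P$ and a constant $C$ such that, for every closed prime term $t$ and every complete Target TAM run $\rho$ from the initial state of $t$, the following holds with $B:=(|\rho|_{\beta_v}+1)\cdot\max(1,|t|)$.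 1. The number of transitions is at most bilinear: $|\rho|\le C\cdot B$. 2. Started on any memory containing a representation of $t$ (and given its address and the address of the first free cell), $P$ implements $\rho$ in time $O(B)$: it goes successively through representations of all the states of $\rho$, and it halts in a representation of the last one after $T\le C\cdot B$ steps in total. Moreover, $P$ reaches the representation of the initial state in at most $C$ steps, and then every transition is implemented in at most $C$ steps, except that the transitions from a focus $\circ\langle t_1,\dots,t_n\rangle$ or $\circ[t\,|\,p_1\dots p_n]$ take at most $C\cdot(n+1)$ steps; the cost of these traversals is absorbed by the total bound $T\le C\cdot B$. -/

import Mathlib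

namespace TargetTAM

/-! ### The target calculus -/

/-- The two variables of the target calculus: `l` (wrapped) and `s` (source). -/
inductive Var where
  | l
  | s
  deriving DecidableEq

/-- Projected variables: `⟨v, k⟩` is `π_{k+1} v`, so that indices start from 1. -/
structure PVar where
  var : Var
  idx : ℕ

/-- Terms of the target calculus: `proj k t` is `π_{k+1} t`, and `clos n m t b` is the closure
with body `t` and bag `b`, annotated with `n` and `m`. Bags are arbitrary lists of terms here;
`Term.Prime` below restricts them to tuples of projected variables. -/
inductive Term where
  | pvar (p : PVar)
  | proj (k : ℕ) (t : Term)
  | tuple (ts : List Term)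
  | app (t u : Term)
  | clos (n m : ℕ) (body : Term) (bag : List Term)

/-- `Term.Occurs p t`: the projected variable `p` appears in `t` out of closure bodies. -/
inductive Term.Occurs (p : PVar) : Term → Prop where
  | pvar : Term.Occurs p (.pvar p)
  | proj {k : ℕ} {t : Term} : Term.Occurs p t → Term.Occurs p (.proj k t)
  | tuple {ts : List Term} {t : Term} : t ∈ ts → Term.Occurs p t → Term.Occurs p (.tuple ts)
  | appL {t u : Term} : Term.Occurs p t → Term.Occurs p (.app t u)
  | appR {t u : Term} : Term.Occurs p u → Term.Occurs p (.app t u)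
  | bag {n m : ℕ} {body : Term} {bag : List Term} {t : Term} :
      t ∈ bag → Term.Occurs p t → Term.Occurs p (.clos n m body bag)

/-- A term is closed if no projected variable occurs in it out of closure bodies. -/
def Term.Closed (t : Term) : Prop := ∀ p : PVar, ¬ Term.Occurs p t

/-- `‖t‖_v ≤ n`, where `‖t‖_v` is the maximum `i` such that `π_i v` appears in `t` out of
closure bodies. -/
def Term.NormLE (v : Var) (t : Term) (n : ℕ) : Prop :=
  ∀ k : ℕ, Term.Occurs ⟨v, k⟩ t → k + 1 ≤ n

/-- Prime terms: all closures are well-formed (the indices of the projected variables of the body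
are bounded by the annotations, and the bag has the length given by the first annotation) and all
bags are tuples of projected variables. -/
inductive Term.Prime : Term → Prop where
  | pvar (p : PVar) : Term.Prime (.pvar p)
  | proj (k : ℕ) {t : Term} : Term.Prime t → Term.Prime (.proj k t)
  | tuple {ts : List Term} : (∀ t ∈ ts, Term.Prime t) → Term.Prime (.tuple ts)
  | app {t u : Term} : Term.Prime t → Term.Prime u → Term.Prime (.app t u)
  | clos {n m : ℕ} {body : Term} (ps : List PVar) : Term.Prime body →
      Term.NormLE .l body n → Term.NormLE .s body m → ps.length = n →
      Term.Prime (.clos n m body (ps.map Term.pvar))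

mutual
/-- The size of a term. The bag of a closure is accounted for by the annotation `n`. -/
def Term.size : Term → ℕ
  | .pvar _ => 1
  | .proj _ t => Term.size t + 1
  | .tuple ts => ts.length + Term.sizes ts
  | .app t u => Term.size t + Term.size u + 1
  | .clos n m body _ => Term.size body + n + m
/-- The sum of the sizes of the terms of a list. -/
def Term.sizes : List Term → ℕ
  | [] => 0
  | t :: ts => Term.size t + Term.sizes ts
end

/-! ### The Target TAM -/

/-- Evaluated values `●v`: evaluated tuples, and evaluated closures `●[○t | ●v₁ … ●vₙ]`. -/
inductive EVal where
  | tuple (vs : List EVal)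
  | clos (body : Term) (bag : List EVal)

/-- The focus of a state: `○t` or `●v`. -/
inductive Focus where
  | code (t : Term)
  | val (v : EVal)

/-- Tupled environments: a pair of tuples of evaluated values. -/
structure Env where
  l : List EVal
  s : List EVal

/-- Look-up in a tupled environment (undefined if the index is too large). -/
def Env.lookup (E : Env) (p : PVar) : Option EVal :=
  match p.var with
  | .l => E.l[p.idx]?
  | .s => E.s[p.idx]?

/-- Entries of constructor stacks: `○t`, `●v`, `π_{k+1}`, and `⟨○t₁, …, ○tₕ, ↓, ●v₁, …, ●vⱼ⟩`. -/
inductive Entry where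
  | code (t : Term)
  | val (v : EVal)
  | proj (k : ℕ)
  | tup (ts : List Term) (vs : List EVal)

/-- States: focus, constructor stack, environment, activation stack. -/
structure State where
  focus : Focus
  cstack : List Entry
  env : Env
  astack : List (List Entry × Env)

/-- The initial state for `t`. -/
def State.init (t : Term) : State := ⟨.code t, [], ⟨[], []⟩, []⟩

/-- Transition labels; the prefixes `c` and `b` stand for the flags `○` and `●`.
The principal transitions are `bpi` and `bbeta`. -/
inductive Label where
  | csea1 | csea2 | csea3 | csea4 | csubw | csubv
  | bsea1 | bsea6 | bsea3 | bpi | bbeta | bsea7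
  deriving DecidableEq

/-- The transitions of the Target TAM. -/
inductive Step : Label → State → State → Prop where
  | csea1 (t u : Term) (S : List Entry) (E : Env) (A : List (List Entry × Env)) :
      Step .csea1 ⟨.code (.app t u), S, E, A⟩ ⟨.code u, .code t :: S, E, A⟩
  | csea2 (k : ℕ) (t : Term) (S : List Entry) (E : Env) (A : List (List Entry × Env)) :
      Step .csea2 ⟨.code (.proj k t), S, E, A⟩ ⟨.code t, .proj k :: S, E, A⟩
  | csea3 (ts : List Term) (t : Term) (S : List Entry) (E : Env)
      (A : List (List Entry × Env)) :
      Step .csea3 ⟨.code (.tuple (ts ++ [t])), S, E, A⟩ ⟨.code t, .tup ts [] :: S, E, A⟩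
  | csea4 (S : List Entry) (E : Env) (A : List (List Entry × Env)) :
      Step .csea4 ⟨.code (.tuple []), S, E, A⟩ ⟨.val (.tuple []), S, E, A⟩
  | csubw (n m : ℕ) (t : Term) (ps : List PVar) (vs : List EVal) (S : List Entry) (E : Env)
      (A : List (List Entry × Env)) :
      List.Forall₂ (fun p v => E.lookup p = some v) ps vs →
      Step .csubw ⟨.code (.clos n m t (ps.map Term.pvar)), S, E, A⟩ ⟨.val (.clos t vs), S, E, A⟩
  | csubv (p : PVar) (v : EVal) (S : List Entry) (E : Env) (A : List (List Entry × Env)) :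
      E.lookup p = some v →
      Step .csubv ⟨.code (.pvar p), S, E, A⟩ ⟨.val v, S, E, A⟩
  | bsea1 (v : EVal) (t : Term) (S : List Entry) (E : Env) (A : List (List Entry × Env)) :
      Step .bsea1 ⟨.val v, .code t :: S, E, A⟩ ⟨.code t, .val v :: S, E, A⟩
  | bsea6 (v : EVal) (ts : List Term) (t : Term) (vs : List EVal) (S : List Entry) (E : Env)
      (A : List (List Entry × Env)) :
      Step .bsea6 ⟨.val v, .tup (ts ++ [t]) vs :: S, E, A⟩
        ⟨.code t, .tup ts (v :: vs) :: S, E, A⟩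
  | bsea3 (v : EVal) (vs : List EVal) (S : List Entry) (E : Env)
      (A : List (List Entry × Env)) :
      Step .bsea3 ⟨.val v, .tup [] vs :: S, E, A⟩ ⟨.val (.tuple (v :: vs)), S, E, A⟩
  | bpi (vs : List EVal) (k : ℕ) (v : EVal) (S : List Entry) (E : Env)
      (A : List (List Entry × Env)) :
      vs[k]? = some v →
      Step .bpi ⟨.val (.tuple vs), .proj k :: S, E, A⟩ ⟨.val v, S, E, A⟩
  | bbeta (t : Term) (vs ws : List EVal) (S : List Entry) (E : Env)
      (A : List (List Entry × Env)) :
      Step .bbeta ⟨.val (.clos t vs), .val (.tuple ws) :: S, E, A⟩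
        ⟨.code t, [], ⟨vs, ws⟩, (S, E) :: A⟩
  | bsea7 (v : EVal) (E : Env) (S : List Entry) (E' : Env) (A : List (List Entry × Env)) :
      Step .bsea7 ⟨.val v, [], E, (S, E') :: A⟩ ⟨.val v, S, E', A⟩

/-- A state is final if no transition applies. -/
def State.Final (s : State) : Prop := ∀ (a : Label) (s' : State), ¬ Step a s s'

/-- A run: a sequence of `len` transitions. Only the states `state 0, …, state len` and the labels
`label 0, …, label (len - 1)` are relevant. -/
structure Run where
  len : ℕ
  state : ℕ → State
  label : ℕ → Label
  valid : ∀ j < len, Step (label j) (state j) (state (j + 1))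

/-- The number of `β`-transitions of a run. -/
def Run.betaCount (ρ : Run) : ℕ :=
  ((Finset.range ρ.len).filter (fun j => ρ.label j = Label.bbeta)).card

/-- A run is complete if it ends on a final state. -/
def Run.Complete (ρ : Run) : Prop := (ρ.state ρ.len).Final

/-- The width of the tuple or of the bag that a transition from the given state has to traverse:
it is non-zero only if the focus is `○⟨t₁, …, tₙ⟩` or `○[t | p₁ … pₙ]`, with `n > 0`. -/
def State.width (s : State) : ℕ :=
  match s.focus with
  | .code (.tuple ts) => ts.length
  | .code (.clos _ _ _ bag) => bag.length
  | _ => 0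

/-! ### Random access machines -/

/-- Instructions of random access machines. Registers and memory cells contain natural numbers.
* `const d n`: set register `d` to `n`;
* `move d r`: copy register `r` to register `d`;
* `add d r r'`, `sub d r r'`: (truncated) sum and difference of `r` and `r'`, stored in `d`;
* `load d r`: store in register `d` the memory cell whose address is in register `r`;
* `store r r'`: store the content of register `r'` in the cell whose address is in register `r`;
* `jump n`: jump to instruction `n`;
* `jumpz r n`: jump to instruction `n` if register `r` contains zero. -/
inductive Instr where
  | const (d n : ℕ)
  | move (d r : ℕ)
  | add (d r r' : ℕ)
  | sub (d r r' : ℕ)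
  | load (d r : ℕ)
  | store (r r' : ℕ)
  | jump (n : ℕ)
  | jumpz (r n : ℕ)

/-- Configurations: program counter, registers (a program uses finitely many), memory. -/
structure Config where
  pc : ℕ
  reg : ℕ → ℕ
  mem : ℕ → ℕ

/-- The effect of one instruction. -/
def Instr.exec (c : Config) : Instr → Config
  | .const d n => ⟨c.pc + 1, Function.update c.reg d n, c.mem⟩
  | .move d r => ⟨c.pc + 1, Function.update c.reg d (c.reg r), c.mem⟩
  | .add d r r' => ⟨c.pc + 1, Function.update c.reg d (c.reg r + c.reg r'), c.mem⟩
  | .sub d r r' => ⟨c.pc + 1, Function.update c.reg d (c.reg r - c.reg r'), c.mem⟩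
  | .load d r => ⟨c.pc + 1, Function.update c.reg d (c.mem (c.reg r)), c.mem⟩
  | .store r r' => ⟨c.pc + 1, c.reg, Function.update c.mem (c.reg r) (c.reg r')⟩
  | .jump n => ⟨n, c.reg, c.mem⟩
  | .jumpz r n => ⟨if c.reg r = 0 then n else c.pc + 1, c.reg, c.mem⟩

/-- One unit-time step of the program `P`; the machine halts (`none`) when the program counter is
out of the program. -/
def ramStep (P : List Instr) (c : Config) : Option Config :=
  (P[c.pc]?).map (Instr.exec c)

/-- The configuration reached after exactly `n` steps, if the machine does not halt earlier. -/
def ramExec (P : List Instr) (c : Config) : ℕ → Option Config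
  | 0 => some c
  | n + 1 => (ramExec P c n).bind (ramStep P)

/-! ### Representation of terms and states in memory

Objects are laid out in blocks of consecutive cells and denoted by the address of their first
cell. Sub-objects are referred to by address, so that they can be shared. A heap
is a partial memory. -/

/-- Partial memories. -/
abbrev Heap := ℕ → Option ℕ

mutual
/-- `Term.Rep h a t`: the block at address `a` represents the term `t`. -/
def Term.Rep (h : Heap) : ℕ → Term → Prop
  | a, .pvar p => h a = some (match p.var with | .l => 0 | .s => 1) ∧ h (a + 1) = some p.idx
  | a, .proj k t => h a = some 2 ∧ h (a + 1) = some k ∧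
      ∃ b, h (a + 2) = some b ∧ Term.Rep h b t
  | a, .tuple ts => h a = some 3 ∧
      ∃ q, h (a + 1) = some q ∧ h q = some ts.length ∧ Term.Reps h (q + 1) ts
  | a, .app t u => h a = some 4 ∧
      (∃ b, h (a + 1) = some b ∧ Term.Rep h b t) ∧ ∃ b, h (a + 2) = some b ∧ Term.Rep h b u
  | a, .clos n m body bag => h a = some 5 ∧ h (a + 1) = some n ∧ h (a + 2) = some m ∧
      (∃ b, h (a + 3) = some b ∧ Term.Rep h b body) ∧
      ∃ q, h (a + 4) = some q ∧ h q = some bag.length ∧ Term.Reps h (q + 1) bag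
/-- The consecutive cells from address `a` contain the addresses of the terms of the list. -/
def Term.Reps (h : Heap) : ℕ → List Term → Prop
  | _, [] => True
  | a, t :: ts => (∃ b, h a = some b ∧ Term.Rep h b t) ∧ Term.Reps h (a + 1) ts
end

mutual
/-- `EVal.Rep h a v`: the block at address `a` represents the evaluated value `v`. -/
def EVal.Rep (h : Heap) : ℕ → EVal → Prop
  | a, .tuple vs => h a = some 0 ∧
      ∃ q, h (a + 1) = some q ∧ h q = some vs.length ∧ EVal.Reps h (q + 1) vs
  | a, .clos body bag => h a = some 1 ∧
      (∃ q, h (a + 1) = some q ∧ h q = some bag.length ∧ EVal.Reps h (q + 1) bag) ∧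
      ∃ b, h (a + 2) = some b ∧ Term.Rep h b body
/-- The consecutive cells from address `a` contain the addresses of the values of the list. -/
def EVal.Reps (h : Heap) : ℕ → List EVal → Prop
  | _, [] => True
  | a, v :: vs => (∃ b, h a = some b ∧ EVal.Rep h b v) ∧ EVal.Reps h (a + 1) vs
end

/-- An array of values at address `q`: its length, followed by the addresses of its elements. -/
def arrayRep (h : Heap) (q : ℕ) (vs : List EVal) : Prop :=
  h q = some vs.length ∧ EVal.Reps h (q + 1) vs

/-- The entry of a constructor stack represented at address `a`; the cell `a + 1` is reserved for
the rest of the stack. For `⟨○t₁, …, ○tₕ, ↓, ●v₁, …, ●vⱼ⟩` the entry contains the address of an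
array of (addresses of) terms that starts with `t₁, …, tₕ`, the number `h`, and the address of an
array of length `h + 1 + j`, the last `j` elements of which are `v₁, …, vⱼ`. -/
def Entry.Rep (h : Heap) (a : ℕ) : Entry → Prop
  | .code t => h a = some 0 ∧ ∃ b, h (a + 2) = some b ∧ Term.Rep h b t
  | .val v => h a = some 1 ∧ ∃ b, h (a + 2) = some b ∧ EVal.Rep h b v
  | .proj k => h a = some 2 ∧ h (a + 2) = some k
  | .tup ts vs => h a = some 3 ∧
      (∃ q, h (a + 2) = some q ∧ Term.Reps h (q + 1) ts) ∧
      h (a + 3) = some ts.length ∧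
      ∃ q, h (a + 4) = some q ∧ h q = some (ts.length + 1 + vs.length) ∧
        EVal.Reps h (q + 1 + ts.length + 1) vs

/-- Constructor stacks are linked lists; the address `0` is the empty stack. -/
def cstackRep (h : Heap) : ℕ → List Entry → Prop
  | a, [] => a = 0
  | a, e :: S => a ≠ 0 ∧ Entry.Rep h a e ∧ ∃ b, h (a + 1) = some b ∧ cstackRep h b S

/-- Activation stacks are linked lists; the address `0` is the empty stack. -/
def astackRep (h : Heap) : ℕ → List (List Entry × Env) → Prop
  | a, [] => a = 0
  | a, (S, E) :: A => a ≠ 0 ∧ (∃ b, h a = some b ∧ cstackRep h b S) ∧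
      (∃ q, h (a + 1) = some q ∧ arrayRep h q E.l) ∧
      (∃ q, h (a + 2) = some q ∧ arrayRep h q E.s) ∧
      ∃ b, h (a + 3) = some b ∧ astackRep h b A

/-- A configuration represents a state if register 0 contains the address of the focus, register 2
its flag (0 for `○`, 1 for `●`), register 3 the constructor stack, registers 4 and 5 the two tuples
of the environment, and register 6 the activation stack. -/
def Config.Represents (c : Config) (s : State) : Prop :=
  (match s.focus with
    | .code t => c.reg 2 = 0 ∧ Term.Rep (fun a => some (c.mem a)) (c.reg 0) t
    | .val v => c.reg 2 = 1 ∧ EVal.Rep (fun a => some (c.mem a)) (c.reg 0) v) ∧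
  cstackRep (fun a => some (c.mem a)) (c.reg 3) s.cstack ∧
  arrayRep (fun a => some (c.mem a)) (c.reg 4) s.env.l ∧
  arrayRep (fun a => some (c.mem a)) (c.reg 5) s.env.s ∧
  astackRep (fun a => some (c.mem a)) (c.reg 6) s.astack

/-- `Config.IsInput c t`: the configuration is about to execute the first instruction, register 0
contains the address of a representation of `t` that only uses memory cells of address smaller than
the content of register 1, and all the other registers contain 0. The cells from the address in
register 1 on are free, and have arbitrary content. -/
def Config.IsInput (c : Config) (t : Term) : Prop :=
  c.pc = 0 ∧ (∀ r, 2 ≤ r → c.reg r = 0) ∧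
  Term.Rep (fun a => if a < c.reg 1 then some (c.mem a) else none) (c.reg 0) t

/-- `Implements P C ρ c₀ T`: from the configuration `c₀`, the program `P` implements the run `ρ` in
time `T`. Namely, it goes in order, at times `τ 0 < τ 1 < …`, through representations of all the
states of `ρ`, and it halts after exactly `T` steps in a representation of the last state.
Moreover, the cost of every transition is bounded by the constant `C`, but for those having to
traverse a tuple or a bag, for which it is at most linear in its width. -/
def Implements (P : List Instr) (C : ℕ) (ρ : Run) (c₀ : Config) (T : ℕ) : Prop :=
  ∃ τ : ℕ → ℕ,
    τ 0 ≤ C ∧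
    (∀ j < ρ.len, τ j < τ (j + 1) ∧ τ (j + 1) ≤ τ j + C * ((ρ.state j).width + 1)) ∧
    (∀ j ≤ ρ.len, ∃ c, ramExec P c₀ (τ j) = some c ∧ c.Represents (ρ.state j)) ∧
    τ ρ.len ≤ T ∧
    ∃ c, ramExec P c₀ T = some c ∧ ramStep P c = none ∧ c.Represents (ρ.state ρ.len)

end TargetTAM

namespace TargetTAM

/-! ### Determinism -/

-- Length. Code is only ever copied, never built, so in a run from `t` all code is prime and of size
-- at most M = |t| (`State.OK.step`). A potential charges 3 per unit of size of pending code, plus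
-- constants for pending stack entries and frames. A transition that traverses width w lowers it by
-- at least w + 1, except that β may first raise it by 3M + 3, for the body it opens
-- (`Step.potential_le`). Telescoping bounds the sum of all w + 1, hence the length and the
-- traversal cost, by 3M + 1 + (3M + 3)·β.
--
-- Simulation. The machine allocates fresh blocks at a free-cell pointer and never alters a cell on
-- which a representation depends. Representations are therefore stable under heap extension, and
-- values, bags and environments are shared by address, so that β takes constant time. The exception
-- is the array of a partly evaluated tuple, allocated with its full length and filled from right to
-- left. Its unwritten cells are kept out of the abstract heap, and the address ranges reserved for
-- different stack entries are disjoint and ordered, so that filling a cell of the top entry leaves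
-- everything below intact.
--
-- From any represented state the machine either performs some transition in time linear in the
-- width, or halts because none applies (`reach_outcome`). Every failed test (look-up, projection,
-- shape of a value) halts, so stuck states need no separate argument. Determinism identifies the
-- transition performed with the one in the run, and the two bounds combine.

theorem lookup_functional {E : Env} {ps : List PVar} {vs ws : List EVal}
    (h₁ : List.Forall₂ (fun p v => E.lookup p = some v) ps vs)
    (h₂ : List.Forall₂ (fun p v => E.lookup p = some v) ps ws) : vs = ws := by
  induction h₁ generalizing ws with
  | nil => cases h₂; rfl
  | cons h _ ih =>
    cases h₂ with
    | cons h' t' => rw [ih t', Option.some.inj (h.symm.trans h')]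

theorem map_pvar_injective : Function.Injective (List.map Term.pvar) :=
  List.map_injective_iff.2 fun _ _ h => by simpa using h

/-- The two sources are separate variables related by an equation because they contain `ts ++ [t]`
and `ps.map Term.pvar`, on which unification by `cases` would get stuck; `simp` splits the equation
instead. -/
theorem Step.deterministic {a b : Label} {s s' s₁ s₂ : State} (h₁ : Step a s s₁)
    (h₂ : Step b s' s₂) (e : s = s') : s₁ = s₂ := by
  cases h₁ <;> cases h₂ <;> simp only [State.mk.injEq, Focus.code.injEq, Focus.val.injEq,
    Term.app.injEq, Term.proj.injEq, Term.tuple.injEq, Term.clos.injEq, Term.pvar.injEq,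
    EVal.tuple.injEq, EVal.clos.injEq, List.cons.injEq, Entry.code.injEq, Entry.val.injEq,
    Entry.proj.injEq, Entry.tup.injEq, Prod.mk.injEq, reduceCtorEq, false_and, and_false,
    List.append_eq_nil_iff, List.nil_eq_append_iff, List.cons_ne_nil] at e
  case csubw.csubw =>
    obtain ⟨⟨rfl, rfl, rfl, h⟩, rfl, rfl, rfl⟩ := e
    obtain rfl := map_pvar_injective h
    simp only [State.mk.injEq, Focus.val.injEq, EVal.clos.injEq, true_and, and_true]
    exact lookup_functional ‹_› ‹_›
  all_goals simp_all

/-! ### Invariants of runs -/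

/-- The term is prime and its size is at most `M`. -/
def Term.OK (M : ℕ) (t : Term) : Prop := t.Prime ∧ t.size ≤ M

/-- All the bodies in the value are prime and of size at most `M`. -/
inductive EVal.OK (M : ℕ) : EVal → Prop where
  | tuple {vs : List EVal} : (∀ v ∈ vs, EVal.OK M v) → EVal.OK M (.tuple vs)
  | clos {t : Term} {vs : List EVal} : t.OK M → (∀ v ∈ vs, EVal.OK M v) → EVal.OK M (.clos t vs)

def Focus.OK (M : ℕ) : Focus → Prop
  | .code t => t.OK M
  | .val v => v.OK M

def Entry.OK (M : ℕ) : Entry → Prop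
  | .code t => t.OK M
  | .val v => v.OK M
  | .proj _ => True
  | .tup ts vs => (∀ t ∈ ts, t.OK M) ∧ ∀ v ∈ vs, v.OK M

def Env.OK (M : ℕ) (E : Env) : Prop := (∀ v ∈ E.l, v.OK M) ∧ ∀ v ∈ E.s, v.OK M

/-- This is the subterm property in the form needed: the size bound limits what β adds to the
potential, and primeness ties the length of a bag to the annotation counted in the size. -/
structure State.OK (M : ℕ) (s : State) : Prop where
  focus : s.focus.OK M
  cstack : ∀ e ∈ s.cstack, e.OK M
  env : s.env.OK M
  astack : ∀ x ∈ s.astack, (∀ e ∈ x.1, e.OK M) ∧ x.2.OK M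

theorem Env.OK.lookup {M : ℕ} {E : Env} (h : E.OK M) {p : PVar} {v : EVal}
    (e : E.lookup p = some v) : v.OK M := by
  unfold Env.lookup at e
  split at e
  · exact h.1 _ (List.mem_of_getElem? e)
  · exact h.2 _ (List.mem_of_getElem? e)

theorem Term.size_le_sizes {t : Term} {ts : List Term} (h : t ∈ ts) :
    t.size ≤ Term.sizes ts := by
  induction ts with
  | nil => cases h
  | cons u us ih =>
    rw [Term.sizes]
    rcases List.mem_cons.1 h with rfl | h
    · omega
    · have := ih h; omega

theorem Term.sizes_append (ts us : List Term) :
    Term.sizes (ts ++ us) = Term.sizes ts + Term.sizes us := by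
  induction ts with
  | nil => simp [Term.sizes]
  | cons u ts ih => simp [Term.sizes, ih, add_assoc]

theorem Term.OK.of_tuple {M : ℕ} {ts : List Term} (h : (Term.tuple ts).OK M) :
    ∀ t ∈ ts, t.OK M := by
  obtain ⟨hp, hs⟩ := h
  cases hp with
  | tuple hp =>
    intro t ht
    have := Term.size_le_sizes ht
    rw [Term.size] at hs
    exact ⟨hp t ht, by omega⟩

theorem Term.OK.of_app {M : ℕ} {t u : Term} (h : (Term.app t u).OK M) : t.OK M ∧ u.OK M := by
  obtain ⟨hp, hs⟩ := h
  cases hp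
  rw [Term.size] at hs
  exact ⟨⟨‹_›, by omega⟩, ‹_›, by omega⟩

theorem Term.OK.of_proj {M k : ℕ} {t : Term} (h : (Term.proj k t).OK M) : t.OK M := by
  obtain ⟨hp, hs⟩ := h
  cases hp
  rw [Term.size] at hs
  exact ⟨‹_›, by omega⟩

theorem Term.OK.of_clos {M n m : ℕ} {t : Term} {b : List Term} (h : (Term.clos n m t b).OK M) :
    t.OK M := by
  obtain ⟨hp, hs⟩ := h
  cases hp
  rw [Term.size] at hs
  exact ⟨‹_›, by omega⟩

theorem Term.Prime.bag {n m : ℕ} {t : Term} {b : List Term} (h : (Term.clos n m t b).Prime) :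
    b.length = n ∧ ∃ ps : List PVar, b = ps.map Term.pvar := by
  cases h with
  | clos ps _ _ _ h => exact ⟨by simpa using h, ps, rfl⟩

theorem EVal.OK.of_tuple {M : ℕ} {vs : List EVal} (h : (EVal.tuple vs).OK M) :
    ∀ v ∈ vs, v.OK M := by
  cases h; assumption

theorem State.OK.init (t : Term) (h : t.Prime) : (State.init t).OK t.size :=
  ⟨⟨h, le_rfl⟩, by simp [State.init], by simp [State.init, Env.OK], by simp [State.init]⟩

theorem State.OK.step {M : ℕ} {a : Label} {s s' : State} (h : s.OK M) (st : Step a s s') :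
    s'.OK M := by
  obtain ⟨hf, hS, hE, hA⟩ := h
  cases st with
  | csea1 t u =>
    obtain ⟨h₁, h₂⟩ := Term.OK.of_app hf
    exact ⟨h₂, List.forall_mem_cons.2 ⟨h₁, hS⟩, hE, hA⟩
  | csea2 k t => exact ⟨Term.OK.of_proj hf, List.forall_mem_cons.2 ⟨trivial, hS⟩, hE, hA⟩
  | csea3 ts t =>
    have h := Term.OK.of_tuple hf
    exact ⟨h t (by simp), List.forall_mem_cons.2
      ⟨⟨fun u hu => h u (by simp [hu]), by simp⟩, hS⟩, hE, hA⟩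
  | csea4 => exact ⟨.tuple (by simp), hS, hE, hA⟩
  | csubw n m t ps vs S E A hl =>
    refine ⟨.clos (Term.OK.of_clos hf) ?_, hS, hE, hA⟩
    clear hf
    induction hl with
    | nil => simp
    | cons h _ ih => exact List.forall_mem_cons.2 ⟨hE.lookup h, ih hS hE hA⟩
  | csubv p v S E A hl => exact ⟨hE.lookup hl, hS, hE, hA⟩
  | bsea1 v t =>
    obtain ⟨h, hS⟩ := List.forall_mem_cons.1 hS
    exact ⟨h, List.forall_mem_cons.2 ⟨hf, hS⟩, hE, hA⟩
  | bsea6 v ts t vs =>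
    obtain ⟨⟨h, h'⟩, hS⟩ := List.forall_mem_cons.1 hS
    exact ⟨h t (by simp), List.forall_mem_cons.2
      ⟨⟨fun u hu => h u (by simp [hu]), List.forall_mem_cons.2 ⟨hf, h'⟩⟩, hS⟩, hE, hA⟩
  | bsea3 v vs =>
    obtain ⟨⟨h, h'⟩, hS⟩ := List.forall_mem_cons.1 hS
    exact ⟨.tuple (List.forall_mem_cons.2 ⟨hf, h'⟩), hS, hE, hA⟩
  | bpi vs k v S E A hk =>
    exact ⟨EVal.OK.of_tuple hf v (List.mem_of_getElem? hk), (List.forall_mem_cons.1 hS).2, hE, hA⟩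
  | bbeta t vs ws S E A =>
    obtain ⟨h, hS⟩ := List.forall_mem_cons.1 hS
    cases hf with
    | clos h₁ h₂ =>
      exact ⟨h₁, by simp, ⟨h₂, EVal.OK.of_tuple h⟩, List.forall_mem_cons.2 ⟨⟨hS, hE⟩, hA⟩⟩
  | bsea7 v E S E' A =>
    obtain ⟨h, hA⟩ := List.forall_mem_cons.1 hA
    exact ⟨hf, h.1, h.2, hA⟩

theorem State.OK.width_le {M : ℕ} {s : State} (h : s.OK M) : s.width ≤ M := by
  obtain ⟨f, S, E, A⟩ := s
  have hf := h.focus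
  unfold State.width
  dsimp only
  split
  · have := hf.2
    rw [Term.size] at this
    omega
  · have := hf.2
    have := hf.1.bag.1
    simp only [Term.size] at *
    omega
  · omega

/-! ### The potential of a state -/

/-- The weights are forced by tuples: width n costs n + 1 to open and n to collect the values, and
its components carry n further units through their own `+ 1`, in all 3n + 1. The `+ 1` also pays for
`○⟨⟩`, which has size 0. -/
def Focus.potential : Focus → ℕ
  | .code t => 3 * t.size + 1
  | .val _ => 0

/-- An entry prepays the transition that consumes it: 1 for a projection or for closing a tuple, and
2 for each waiting term, namely 1 to fetch it and 1 for the constant of a code focus. -/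
def Entry.potential : Entry → ℕ
  | .code t => 3 * t.size + 2
  | .val _ => 0
  | .proj _ => 1
  | .tup ts _ => 3 * Term.sizes ts + 2 * ts.length + 1

def cstackPotential (S : List Entry) : ℕ := (S.map Entry.potential).sum

/-- An upper bound on the cost of the transitions before the next `β`-transition. -/
def State.potential (s : State) : ℕ :=
  s.focus.potential + cstackPotential s.cstack +
    (s.astack.map fun x => 1 + cstackPotential x.1).sum

/-- The bound 3M + 3 for β is the transition itself, at most 3M + 1 for the body that becomes the
focus, and 1 for the later return from the new frame. -/
theorem Step.potential_le {M : ℕ} {a : Label} {s s' : State} (h : s.OK M) (st : Step a s s') :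
    s.width + 1 + s'.potential ≤
      s.potential + if a = Label.bbeta then 3 * M + 3 else 0 := by
  cases st <;> simp [State.width, State.potential, Focus.potential, Entry.potential,
    cstackPotential, Term.size, Term.sizes, Term.sizes_append]
  -- The width is the length of the bag, whereas the size counts the annotation; primeness equates
  -- them.
  case csubw => have := h.focus.1.bag.1; simp at this; omega
  case bbeta =>
    have := h.focus
    cases this with
    | clos h => have := h.2; omega
  all_goals omega

/-! ### Extensions of heaps -/

/-- `h'` extends `h`, and no cell of address smaller than `b` is added. -/
def Heap.Ext (b : ℕ) (h h' : Heap) : Prop :=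
  (∀ x v, h x = some v → h' x = some v) ∧ ∀ x < b, h x = none → h' x = none

theorem Heap.Ext.refl (b : ℕ) (h : Heap) : Heap.Ext b h h := ⟨fun _ _ => id, fun _ _ => id⟩

theorem Heap.Ext.trans {b : ℕ} {h h' h'' : Heap} (e : Heap.Ext b h h') (e' : Heap.Ext b h' h'') :
    Heap.Ext b h h'' :=
  ⟨fun x v H => e'.1 x v (e.1 x v H), fun x l H => e'.2 x l (e.2 x l H)⟩

theorem Heap.Ext.anti {b b' : ℕ} {h h' : Heap} (e : Heap.Ext b h h') (l : b' ≤ b) :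
    Heap.Ext b' h h' :=
  ⟨e.1, fun x hx => e.2 x (hx.trans_le l)⟩

theorem Heap.Ext.update {b a : ℕ} {h : Heap} (v : ℕ) (l : b ≤ a) (hn : h a = none) :
    Heap.Ext b h (Function.update h a (some v)) := by
  constructor
  · intro x w H
    rw [Function.update_of_ne, H]
    rintro rfl
    simp [hn] at H
  · intro x hx H
    rw [Function.update_of_ne (by omega), H]

/-- The memory `mem` agrees with the heap `h`, the cells of which have address smaller than `b`. -/
def Heap.Coh (h : Heap) (mem : ℕ → ℕ) (b : ℕ) : Prop := ∀ x v, h x = some v → x < b ∧ mem x = v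

theorem Heap.Coh.none {h : Heap} {mem : ℕ → ℕ} {b a : ℕ} (H : h.Coh mem b) (l : b ≤ a) :
    h a = none := by
  cases e : h a with
  | none => rfl
  | some v => have := (H a v e).1; omega

/-- `Config.Represents` reads the whole memory. With bound 0 the clause on added cells is vacuous,
so the memory is an extension even where pending cells hold arbitrary content. -/
theorem Heap.Coh.ext_total {h : Heap} {mem : ℕ → ℕ} {b : ℕ} (H : h.Coh mem b) :
    Heap.Ext 0 h (fun a => some (mem a)) :=
  ⟨fun x v e => congrArg some (H x v e).2, fun x hx => by omega⟩

theorem Heap.Coh.update {h : Heap} {mem : ℕ → ℕ} {b a : ℕ} (H : h.Coh mem b) (v : ℕ)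
    (l : a < b) : Heap.Coh (Function.update h a (some v)) (Function.update mem a v) b := by
  intro x w e
  by_cases hx : x = a
  · subst hx
    simp at e
    simp [e, l]
  · rw [Function.update_of_ne hx] at e
    rw [Function.update_of_ne hx]
    exact H x w e

theorem Heap.Coh.mono {h : Heap} {mem : ℕ → ℕ} {b b' : ℕ} (H : h.Coh mem b) (l : b ≤ b') :
    h.Coh mem b' :=
  fun x v e => ⟨(H x v e).1.trans_le l, (H x v e).2⟩

theorem Heap.Coh.of_ext {h h' : Heap} {mem : ℕ → ℕ} {b n : ℕ} (H : h'.Coh mem b)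
    (e : Heap.Ext n h h') : h.Coh mem b :=
  fun x v hx => H x v (e.1 x v hx)

-- Allocation of blocks of fresh cells.

/-- Write a list of numbers in consecutive cells of the memory. -/
def writes (mem : ℕ → ℕ) (b : ℕ) : List ℕ → ℕ → ℕ
  | [] => mem
  | v :: l => writes (Function.update mem b v) (b + 1) l

/-- Write a list of numbers in consecutive cells of the heap. -/
def Heap.alloc (h : Heap) (b : ℕ) : List ℕ → Heap
  | [] => h
  | v :: l => Heap.alloc (Function.update h b (some v)) (b + 1) l

theorem Heap.Coh.alloc {h : Heap} {mem : ℕ → ℕ} {b : ℕ} (l : List ℕ) (H : h.Coh mem b) :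
    (h.alloc b l).Coh (writes mem b l) (b + l.length) := by
  induction l generalizing h mem b with
  | nil => exact H
  | cons v l ih =>
    have := ih ((H.mono b.le_succ).update v b.lt_succ_self)
    rwa [Nat.succ_eq_add_one, add_assoc, add_comm 1] at this

theorem Heap.Coh.ext_alloc {h : Heap} {mem : ℕ → ℕ} {b : ℕ} (l : List ℕ) (H : h.Coh mem b) :
    Heap.Ext b h (h.alloc b l) := by
  induction l generalizing h mem b with
  | nil => exact .refl _ _
  | cons v l ih =>
    exact (Heap.Ext.update v le_rfl (H.none le_rfl)).trans
      ((ih ((H.mono b.le_succ).update v b.lt_succ_self)).anti b.le_succ)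

theorem Heap.alloc_of_lt (l : List ℕ) {h : Heap} {b x : ℕ} (hx : x < b) :
    h.alloc b l x = h x := by
  induction l generalizing h b with
  | nil => rfl
  | cons v l ih =>
    rw [Heap.alloc, ih (hx.trans b.lt_succ_self), Function.update_of_ne hx.ne]

theorem Heap.alloc_get (l : List ℕ) {h : Heap} {b i v : ℕ} (hi : l[i]? = some v) :
    h.alloc b l (b + i) = some v := by
  induction l generalizing h b i with
  | nil => simp at hi
  | cons w l ih =>
    cases i with
    | zero =>
      rw [Heap.alloc, Heap.alloc_of_lt _ (by omega)]
      simpa using hi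
    | succ i =>
      have := ih (h := Function.update h b (some w)) (b := b + 1) (i := i) (by simpa using hi)
      rwa [add_assoc, add_comm 1] at this

/-! ### Monotonicity of the representations -/

section Mono

variable {b : ℕ} {h h' : Heap}

mutual
-- A representation asserts only that certain cells are defined with given values, so only the first
-- half of `Heap.Ext` matters here.
theorem Term.Rep.mono (e : Heap.Ext b h h') : ∀ (t : Term) (a : ℕ), Term.Rep h a t →
    Term.Rep h' a t
  | .pvar _, _, H => ⟨e.1 _ _ H.1, e.1 _ _ H.2⟩
  | .proj _ t, _, ⟨H, H', c, H'', R⟩ =>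
    ⟨e.1 _ _ H, e.1 _ _ H', c, e.1 _ _ H'', Term.Rep.mono e t c R⟩
  | .tuple ts, _, ⟨H, q, H', H'', R⟩ =>
    ⟨e.1 _ _ H, q, e.1 _ _ H', e.1 _ _ H'', Term.Reps.mono e ts _ R⟩
  | .app t u, _, ⟨H, ⟨c, H', R⟩, d, H'', R'⟩ =>
    ⟨e.1 _ _ H, ⟨c, e.1 _ _ H', Term.Rep.mono e t c R⟩, d, e.1 _ _ H'', Term.Rep.mono e u d R'⟩
  | .clos _ _ t bag, _, ⟨H, H₁, H₂, ⟨c, H₃, R⟩, q, H₄, H₅, R'⟩ =>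
    ⟨e.1 _ _ H, e.1 _ _ H₁, e.1 _ _ H₂, ⟨c, e.1 _ _ H₃, Term.Rep.mono e t c R⟩, q, e.1 _ _ H₄,
      e.1 _ _ H₅, Term.Reps.mono e bag _ R'⟩
theorem Term.Reps.mono (e : Heap.Ext b h h') : ∀ (ts : List Term) (a : ℕ), Term.Reps h a ts →
    Term.Reps h' a ts
  | [], _, _ => trivial
  | t :: ts, _, ⟨⟨c, H, R⟩, R'⟩ => ⟨⟨c, e.1 _ _ H, Term.Rep.mono e t c R⟩, Term.Reps.mono e ts _ R'⟩
end

mutual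
theorem EVal.Rep.mono (e : Heap.Ext b h h') : ∀ (v : EVal) (a : ℕ), EVal.Rep h a v →
    EVal.Rep h' a v
  | .tuple vs, _, ⟨H, q, H', H'', R⟩ =>
    ⟨e.1 _ _ H, q, e.1 _ _ H', e.1 _ _ H'', EVal.Reps.mono e vs _ R⟩
  | .clos t bag, _, ⟨H, ⟨q, H', H'', R⟩, c, H₃, R'⟩ =>
    ⟨e.1 _ _ H, ⟨q, e.1 _ _ H', e.1 _ _ H'', EVal.Reps.mono e bag _ R⟩, c, e.1 _ _ H₃,
      Term.Rep.mono e t c R'⟩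
theorem EVal.Reps.mono (e : Heap.Ext b h h') : ∀ (vs : List EVal) (a : ℕ), EVal.Reps h a vs →
    EVal.Reps h' a vs
  | [], _, _ => trivial
  | v :: vs, _, ⟨⟨c, H, R⟩, R'⟩ => ⟨⟨c, e.1 _ _ H, EVal.Rep.mono e v c R⟩, EVal.Reps.mono e vs _ R'⟩
end

variable (e : Heap.Ext b h h')

include e

theorem arrayRep.mono {q : ℕ} {vs : List EVal} (H : arrayRep h q vs) : arrayRep h' q vs :=
  ⟨e.1 _ _ H.1, EVal.Reps.mono e _ _ H.2⟩

theorem Entry.Rep.mono {a : ℕ} : ∀ {x : Entry}, Entry.Rep h a x → Entry.Rep h' a x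
  | .code t, ⟨H, c, H', R⟩ => ⟨e.1 _ _ H, c, e.1 _ _ H', Term.Rep.mono e t c R⟩
  | .val t, ⟨H, c, H', R⟩ => ⟨e.1 _ _ H, c, e.1 _ _ H', EVal.Rep.mono e t c R⟩
  | .proj _, ⟨H, H'⟩ => ⟨e.1 _ _ H, e.1 _ _ H'⟩
  | .tup _ _, ⟨H, ⟨q, H₁, R⟩, H₂, q', H₃, H₄, R'⟩ =>
    ⟨e.1 _ _ H, ⟨q, e.1 _ _ H₁, Term.Reps.mono e _ _ R⟩, e.1 _ _ H₂, q', e.1 _ _ H₃,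
      e.1 _ _ H₄, EVal.Reps.mono e _ _ R'⟩

end Mono

theorem Term.Reps.append {h : Heap} {ts us : List Term} {a : ℕ} :
    Term.Reps h a (ts ++ us) ↔ Term.Reps h a ts ∧ Term.Reps h (a + ts.length) us := by
  induction ts generalizing a with
  | nil => simp [Term.Reps]
  | cons t ts ih =>
    rw [List.cons_append, Term.Reps, Term.Reps, ih, and_assoc, List.length_cons, add_assoc,
      add_comm 1]

theorem EVal.Reps.get {h : Heap} {vs : List EVal} {a k : ℕ} {v : EVal} (H : EVal.Reps h a vs)
    (hk : vs[k]? = some v) : ∃ c, h (a + k) = some c ∧ EVal.Rep h c v := by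
  induction vs generalizing a k with
  | nil => simp at hk
  | cons w vs ih =>
    rw [EVal.Reps] at H
    cases k with
    | zero =>
      obtain rfl : w = v := by simpa using hk
      exact H.1
    | succ k =>
      have := ih H.2 (k := k) (by simpa using hk)
      rwa [add_assoc, add_comm 1] at this

/-! ### Stacks with pending cells

The array of an entry `⟨○t₁, …, ○tₕ, ↓, ●v₁, …, ●vⱼ⟩` has `h + 1` cells which are still to be
written. Such pending cells do not belong to the heap, and those of an entry have smaller addresses
than those of the entries above it. -/

/-- The pending cells of the entry at address `a` are not in the heap, and their addresses are
between `b'` and `b`. -/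
def Entry.Pending (h : Heap) (a b b' : ℕ) : Entry → Prop
  | .tup ts _ => ∃ q, h (a + 4) = some q ∧ b' ≤ q ∧ q + ts.length + 1 < b ∧
      ∀ i ≤ ts.length, h (q + 1 + i) = none
  | _ => b' ≤ b

/-- The stack is represented at address `a`, and its pending cells have addresses between
`b'` and `b`. -/
def cstackInv (h : Heap) : ℕ → List Entry → ℕ → ℕ → Prop
  | a, [], b, b' => a = 0 ∧ b' ≤ b
  | a, x :: S, b, b' => a ≠ 0 ∧ Entry.Rep h a x ∧ ∃ c, h (a + 1) = some c ∧
      ∃ d, Entry.Pending h a b d x ∧ cstackInv h c S d b'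

/-- The activation stack is represented at address `a`, and its pending cells have addresses
smaller than `b`. -/
def astackInv (h : Heap) : ℕ → List (List Entry × Env) → ℕ → Prop
  | a, [], _ => a = 0
  | a, (S, E) :: A, b => a ≠ 0 ∧
      (∃ c, h a = some c ∧ ∃ q, h (a + 1) = some q ∧ arrayRep h q E.l ∧
        ∃ q', h (a + 2) = some q' ∧ arrayRep h q' E.s ∧
        ∃ a', h (a + 3) = some a' ∧ ∃ d, cstackInv h c S b d ∧ astackInv h a' A d)

theorem Entry.Pending.le {h : Heap} {a b b' : ℕ} : ∀ {x : Entry}, x.Pending h a b b' → b' ≤ b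
  | .code _, H => H
  | .val _, H => H
  | .proj _, H => H
  | .tup ts vs, ⟨q, _, _, _, _⟩ => by omega

/-- Pending cells lie below `b`, where the extension adds nothing, so they remain undefined. -/
theorem Entry.Pending.mono {h h' : Heap} {a b b₁ b' : ℕ} (e : Heap.Ext b h h') (l : b ≤ b₁) :
    ∀ {x : Entry}, x.Pending h a b b' → x.Pending h' a b₁ b'
  | .code _, H => H.trans l
  | .val _, H => H.trans l
  | .proj _, H => H.trans l
  | .tup ts vs, ⟨q, H, H₁, H₂, H₃⟩ =>
    ⟨q, e.1 _ _ H, H₁, by omega, fun i hi => e.2 _ (by omega) (H₃ i hi)⟩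

theorem cstackInv.le {h : Heap} {a b b' : ℕ} {S : List Entry} (H : cstackInv h a S b b') :
    b' ≤ b := by
  induction S generalizing a b with
  | nil => exact H.2
  | cons x S ih =>
    obtain ⟨_, _, c, _, d, hd, H⟩ := H
    exact (ih H).trans hd.le

theorem cstackInv.mono {h h' : Heap} {a b b₁ b' : ℕ} {S : List Entry}
    (H : cstackInv h a S b b') (e : Heap.Ext b h h') (l : b ≤ b₁) : cstackInv h' a S b₁ b' := by
  induction S generalizing a b b₁ with
  | nil => exact ⟨H.1, H.2.trans l⟩
  | cons x S ih =>
    obtain ⟨h0, h1, c, h2, d, hd, H⟩ := H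
    exact ⟨h0, h1.mono e, c, e.1 _ _ h2, d, hd.mono e l, ih H (e.anti hd.le) le_rfl⟩

theorem astackInv.mono {h h' : Heap} {a b b₁ : ℕ} {A : List (List Entry × Env)}
    (H : astackInv h a A b) (e : Heap.Ext b h h') (l : b ≤ b₁) : astackInv h' a A b₁ := by
  induction A generalizing a b b₁ with
  | nil => exact H
  | cons x A ih =>
    obtain ⟨h0, c, h1, q, h2, h3, q', h4, h5, a', h6, d, h7, H⟩ := H
    exact ⟨h0, c, e.1 _ _ h1, q, e.1 _ _ h2, h3.mono e, q', e.1 _ _ h4, h5.mono e, a',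
      e.1 _ _ h6, d, h7.mono e l, ih H (e.anti h7.le) le_rfl⟩

/-- Pending cells play no role in what a stack represents, so the bound `n` of the extension is
arbitrary. -/
theorem cstackInv.rep {n : ℕ} {h h' : Heap} {a b b' : ℕ} {S : List Entry}
    (H : cstackInv h a S b b') (e : Heap.Ext n h h') : cstackRep h' a S := by
  induction S generalizing a b with
  | nil => exact H.1
  | cons x S ih =>
    obtain ⟨h0, h1, c, h2, d, _, H⟩ := H
    exact ⟨h0, h1.mono e, c, e.1 _ _ h2, ih H⟩

theorem astackInv.rep {n : ℕ} {h h' : Heap} {a b : ℕ} {A : List (List Entry × Env)}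
    (H : astackInv h a A b) (e : Heap.Ext n h h') : astackRep h' a A := by
  induction A generalizing a b with
  | nil => exact H
  | cons x A ih =>
    obtain ⟨h0, c, h1, q, h2, h3, q', h4, h5, a', h6, d, h7, H⟩ := H
    exact ⟨h0, ⟨c, e.1 _ _ h1, h7.rep e⟩, ⟨q, e.1 _ _ h2, h3.mono e⟩, ⟨q', e.1 _ _ h4, h5.mono e⟩,
      a', e.1 _ _ h6, ih H⟩

theorem stacks_alloc {h : Heap} {mem : ℕ → ℕ} {b x y : ℕ} {S : List Entry}
    {A : List (List Entry × Env)} (l : List ℕ) (H : h.Coh mem b)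
    (st : ∃ d, cstackInv h x S b d ∧ astackInv h y A d) :
    ∃ d, cstackInv (h.alloc b l) x S (b + l.length) d ∧ astackInv (h.alloc b l) y A d := by
  obtain ⟨d, h₁, h₂⟩ := st
  exact ⟨d, h₁.mono (H.ext_alloc l) (by omega),
    h₂.mono ((H.ext_alloc l).anti h₁.le) le_rfl⟩

-- The invariant of machine configurations.

/-- The focus is represented at address `a`, with the given flag. -/
def Focus.Rep (h : Heap) (flag a : ℕ) : Focus → Prop
  | .code t => flag = 0 ∧ Term.Rep h a t
  | .val v => flag = 1 ∧ EVal.Rep h a v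

theorem Focus.Rep.mono {b flag a : ℕ} {h h' : Heap} (e : Heap.Ext b h h') :
    ∀ {f : Focus}, f.Rep h flag a → f.Rep h' flag a
  | .code t, H => ⟨H.1, Term.Rep.mono e t a H.2⟩
  | .val v, H => ⟨H.1, EVal.Rep.mono e v a H.2⟩

/-- The invariant of the machine: the heap `h` contains a representation of the state and agrees
with the memory, in which all cells from the address in register 1 on are free. -/
structure Config.Inv (c : Config) (h : Heap) (s : State) : Prop where
  coh : h.Coh c.mem (c.reg 1)
  pos : 0 < c.reg 1
  one : c.reg 7 = 1
  focus : s.focus.Rep h (c.reg 2) (c.reg 0)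
  stack : ∃ b, cstackInv h (c.reg 3) s.cstack (c.reg 1) b ∧ astackInv h (c.reg 6) s.astack b
  envl : arrayRep h (c.reg 4) s.env.l
  envs : arrayRep h (c.reg 5) s.env.s

/-- A configuration that differs from one which satisfies the invariant only in temporary registers
and in free cells still represents the same state. -/
theorem Config.Inv.represents {c c' : Config} {h : Heap} {s : State} (H : c.Inv h s) {b : ℕ}
    (hc : h.Coh c'.mem b) (h0 : c'.reg 0 = c.reg 0) (h2 : c'.reg 2 = c.reg 2)
    (h3 : c'.reg 3 = c.reg 3) (h4 : c'.reg 4 = c.reg 4) (h5 : c'.reg 5 = c.reg 5)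
    (h6 : c'.reg 6 = c.reg 6) : c'.Represents s := by
  obtain ⟨f, S, E, A⟩ := s
  obtain ⟨_, _, _, hf, ⟨b, hS, hA⟩, hl, hs⟩ := H
  have e := hc.ext_total
  unfold Config.Represents
  rw [h0, h2, h3, h4, h5, h6]
  refine ⟨?_, hS.rep e, hl.mono e, hs.mono e, hA.rep e⟩
  have := hf.mono e
  cases f <;> exact this

/-! ### The machine -/

/-- From `c`, the program reaches in at most `n` steps a configuration that satisfies `Q`. -/
def Reach (P : List Instr) (c : Config) (n : ℕ) (Q : Config → Prop) : Prop :=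
  ∃ k ≤ n, ∃ c', ramExec P c k = some c' ∧ Q c'

theorem ramExec_add (P : List Instr) (c : Config) (m n : ℕ) :
    ramExec P c (m + n) = (ramExec P c m).bind fun c' => ramExec P c' n := by
  induction n with
  | zero => simp [ramExec]
  | succ n ih => rw [← add_assoc, ramExec, ih, Option.bind_assoc]; rfl

theorem Reach.done {P : List Instr} {c : Config} {n : ℕ} {Q : Config → Prop} (h : Q c) :
    Reach P c n Q :=
  ⟨0, n.zero_le, c, rfl, h⟩

/-- The configuration is an explicit triple so that, at a concrete program counter, `rfl` fetches
the instruction and `simp` computes its effect: the lemmas below execute the program symbolically.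
-/
theorem Reach.step {P : List Instr} {pc n : ℕ} {reg mem : ℕ → ℕ} {i : Instr}
    {Q : Config → Prop} (hi : P[pc]? = some i) (h : Reach P (i.exec ⟨pc, reg, mem⟩) n Q) :
    Reach P ⟨pc, reg, mem⟩ (n + 1) Q := by
  obtain ⟨k, hk, c', h, hQ⟩ := h
  refine ⟨1 + k, by omega, c', ?_, hQ⟩
  rw [ramExec_add]
  simp [ramExec, ramStep, hi, h]

theorem Reach.mono {P : List Instr} {c : Config} {m n : ℕ} {Q : Config → Prop}
    (h : Reach P c m Q) (l : m ≤ n) : Reach P c n Q := by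
  obtain ⟨k, hk, h⟩ := h
  exact ⟨k, hk.trans l, h⟩

/-- The program: register 7 contains 1, the registers from 8 on are temporary. The main loop starts
at 5; values are dispatched from 6 on, and terms from 121 on. The loop over bags starts at 142,
and 218 is the halting address. -/
def machine : List Instr :=
  [.const 7 1, .store 1 2, .move 4 1, .move 5 1, .add 1 1 7,
   .jumpz 2 121, .jumpz 3 112, .load 8 3, .jumpz 8 51, .sub 8 8 7, .jumpz 8 65, .sub 8 8 7,
   .jumpz 8 95, .add 9 3 7, .add 10 9 7, .add 11 10 7, .add 12 11 7, .load 9 9, .load 10 10,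
   .load 13 11, .load 14 12, .add 15 14 7, .add 15 15 13, .jumpz 13 43, .add 11 10 13,
   .load 11 11, .store 15 0, .move 0 11, .const 2 0, .sub 13 13 7,
   .const 8 3, .store 1 8, .move 3 1, .add 1 1 7, .store 1 9, .add 1 1 7, .store 1 10,
   .add 1 1 7, .store 1 13, .add 1 1 7, .store 1 14, .add 1 1 7, .jump 5,
   .store 15 0, .store 1 13, .move 0 1, .add 1 1 7, .store 1 14, .add 1 1 7, .move 3 9, .jump 5,
   .add 9 3 7, .load 10 9, .add 9 9 7, .load 11 9, .const 2 0, .store 1 7, .move 3 1, .add 1 1 7,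
   .store 1 10, .add 1 1 7, .store 1 0, .add 1 1 7, .move 0 11, .jump 5,
   .load 8 0, .jumpz 8 218, .add 9 3 7, .load 10 9, .add 9 9 7, .load 11 9, .load 12 11,
   .jumpz 12 74, .jump 218,
   .add 9 0 7, .load 14 9, .add 9 9 7, .load 0 9, .add 11 11 7, .load 15 11, .move 13 1,
   .store 1 10, .add 1 1 7, .store 1 4, .add 1 1 7, .store 1 5, .add 1 1 7, .store 1 6,
   .add 1 1 7, .move 6 13, .move 4 14, .move 5 15, .const 3 0, .const 2 0, .jump 5,
   .load 8 0, .jumpz 8 98, .jump 218,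
   .add 9 0 7, .load 9 9, .load 10 9, .add 11 3 7, .load 12 11, .add 11 11 7, .load 13 11,
   .sub 10 10 13, .jumpz 10 218, .add 9 9 7, .add 9 9 13, .load 0 9, .move 3 12, .jump 5,
   .jumpz 6 218, .load 3 6, .add 9 6 7, .load 4 9, .add 9 9 7, .load 5 9, .add 9 9 7, .load 6 9,
   .jump 5,
   .load 8 0, .jumpz 8 173, .sub 8 8 7, .jumpz 8 171, .sub 8 8 7, .jumpz 8 184, .sub 8 8 7,
   .jumpz 8 198, .sub 8 8 7, .jumpz 8 185, .add 9 0 7, .add 9 9 7, .add 9 9 7, .load 10 9,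
   .add 9 9 7, .load 9 9, .load 11 9, .add 9 9 7, .move 12 1, .store 12 11, .add 13 12 7,
   .jumpz 11 162, .load 14 9, .load 15 14, .add 14 14 7, .load 14 14, .jumpz 15 150, .move 16 5,
   .jump 151,
   .move 16 4,
   .load 17 16, .sub 17 17 14, .jumpz 17 218, .add 16 16 7, .add 16 16 14, .load 16 16,
   .store 13 16, .add 13 13 7, .add 9 9 7, .sub 11 11 7, .jump 142,
   .move 0 13, .store 13 7, .add 13 13 7, .store 13 12, .add 13 13 7, .store 13 10, .add 1 13 7,
   .const 2 1, .jump 5,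
   .move 16 5, .jump 174,
   .move 16 4,
   .add 9 0 7, .load 14 9, .load 17 16, .sub 17 17 14, .jumpz 17 218, .add 16 16 7,
   .add 16 16 14, .load 0 16, .const 2 1, .jump 5,
   .const 8 2,
   .add 9 0 7, .load 10 9, .add 9 9 7, .load 0 9, .store 1 8, .move 11 1, .add 1 1 7, .store 1 3,
   .add 1 1 7, .store 1 10, .add 1 1 7, .move 3 11, .jump 5,
   .add 9 0 7, .load 10 9, .load 13 10, .jumpz 13 211, .add 11 10 13, .load 0 11, .move 14 1,
   .store 1 13, .add 1 1 7, .add 1 1 13, .sub 13 13 7, .move 9 3, .jump 30,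
   .store 1 13, .move 0 1, .add 1 1 7, .store 1 10, .add 1 1 7, .const 2 1, .jump 5]

/-- A transition from `s` has been implemented, or the state is final and the machine halts. -/
def Outcome (s : State) (c : Config) : Prop :=
  (∃ a s', Step a s s' ∧ c.pc = 5 ∧ ∃ h, c.Inv h s') ∨ c.pc = 218 ∧ s.Final ∧ c.Represents s

/-! ### Transitions from terms -/

theorem reach_app {reg mem : ℕ → ℕ} {h : Heap} {t u : Term} {S : List Entry} {E : Env}
    {A : List (List Entry × Env)} (H : Config.Inv ⟨121, reg, mem⟩ h ⟨.code (.app t u), S, E, A⟩) :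
    Reach machine ⟨121, reg, mem⟩ 40 (Outcome ⟨.code (.app t u), S, E, A⟩) := by
  obtain ⟨coh, pos, one, ⟨h2, hc, ⟨c, hc1, ht⟩, d, hc2, hu⟩, ⟨b, hS, hA⟩, envl, envs⟩ := H
  dsimp only at *
  have m0 := (coh _ _ hc).2
  have m1 := (coh _ _ hc1).2
  have m2 := (coh _ _ hc2).2
  -- The count is the number of instructions on this path, 10 for dispatching on the tag and 13 for
  -- the action; 40 is a uniform upper bound for the constant-time cases.
  iterate 23 (refine Reach.step rfl ?_; simp [Instr.exec, one, m0, m1, m2])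
  have e := coh.ext_alloc [0, reg 3, c]
  refine Reach.done (.inl ⟨_, _, Step.csea1 .., rfl, _, coh.alloc [0, reg 3, c],
    by simp, one, ⟨h2, Term.Rep.mono e _ _ hu⟩, ⟨b, ?_, hA.mono (e.anti hS.le) le_rfl⟩,
    envl.mono e, envs.mono e⟩)
  exact ⟨pos.ne', ⟨Heap.alloc_get (i := 0) _ rfl, c, Heap.alloc_get (i := 2) _ rfl,
    Term.Rep.mono e _ _ ht⟩, reg 3, Heap.alloc_get (i := 1) _ rfl, reg 1, Nat.le_add_right _ 3,
    hS.mono e le_rfl⟩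

theorem reach_proj {reg mem : ℕ → ℕ} {h : Heap} {k : ℕ} {t : Term} {S : List Entry} {E : Env}
    {A : List (List Entry × Env)} (H : Config.Inv ⟨121, reg, mem⟩ h ⟨.code (.proj k t), S, E, A⟩) :
    Reach machine ⟨121, reg, mem⟩ 40 (Outcome ⟨.code (.proj k t), S, E, A⟩) := by
  obtain ⟨coh, pos, one, ⟨h2, hc, hc1, d, hc2, ht⟩, ⟨b, hS, hA⟩, envl, envs⟩ := H
  dsimp only at *
  have m0 := (coh _ _ hc).2
  have m1 := (coh _ _ hc1).2
  have m2 := (coh _ _ hc2).2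
  iterate 20 (refine Reach.step rfl ?_; simp [Instr.exec, one, m0, m1, m2])
  have e := coh.ext_alloc [2, reg 3, k]
  refine Reach.done (.inl ⟨_, _, Step.csea2 .., rfl, _, coh.alloc [2, reg 3, k],
    by simp, one, ⟨h2, Term.Rep.mono e _ _ ht⟩, ⟨b, ?_, hA.mono (e.anti hS.le) le_rfl⟩,
    envl.mono e, envs.mono e⟩)
  exact ⟨pos.ne', ⟨Heap.alloc_get (i := 0) _ rfl, Heap.alloc_get (i := 2) _ rfl⟩, reg 3,
    Heap.alloc_get (i := 1) _ rfl, reg 1, Nat.le_add_right _ 3, hS.mono e le_rfl⟩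

theorem reach_tuple_nil {reg mem : ℕ → ℕ} {h : Heap} {S : List Entry} {E : Env}
    {A : List (List Entry × Env)} (H : Config.Inv ⟨121, reg, mem⟩ h ⟨.code (.tuple []), S, E, A⟩) :
    Reach machine ⟨121, reg, mem⟩ 40 (Outcome ⟨.code (.tuple []), S, E, A⟩) := by
  obtain ⟨coh, pos, one, ⟨h2, hc, q, hc1, hq, _⟩, st, envl, envs⟩ := H
  dsimp only at *
  have m0 := (coh _ _ hc).2
  have m1 := (coh _ _ hc1).2
  have m2 : mem q = 0 := (coh _ _ hq).2
  iterate 19 (refine Reach.step rfl ?_; simp [Instr.exec, one, m0, m1, m2])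
  have e := coh.ext_alloc [0, q]
  exact Reach.done (.inl ⟨_, _, Step.csea4 .., rfl, _, coh.alloc [0, q],
    by simp, one, ⟨rfl, Heap.alloc_get (i := 0) _ rfl, q, Heap.alloc_get (i := 1) _ rfl,
    e.1 _ _ hq, trivial⟩, stacks_alloc [0, q] coh st, envl.mono e, envs.mono e⟩)

theorem reach_tuple_append {reg mem : ℕ → ℕ} {h : Heap} {ts : List Term} {t : Term}
    {S : List Entry} {E : Env} {A : List (List Entry × Env)}
    (H : Config.Inv ⟨121, reg, mem⟩ h ⟨.code (.tuple (ts ++ [t])), S, E, A⟩) :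
    Reach machine ⟨121, reg, mem⟩ 40 (Outcome ⟨.code (.tuple (ts ++ [t])), S, E, A⟩) := by
  obtain ⟨coh, pos, one, ⟨h2, hc, q, hc1, hq, hts⟩, ⟨b, hS, hA⟩, envl, envs⟩ := H
  dsimp only at *
  rw [Term.Reps.append] at hts
  obtain ⟨hts, ⟨c, hc2, ht⟩, -⟩ := hts
  have m0 := (coh _ _ hc).2
  have m1 := (coh _ _ hc1).2
  have m2 : mem q = ts.length + 1 := by simpa using (coh _ _ hq).2
  have m3 : mem (q + (ts.length + 1)) = c := by
    rw [← (coh _ _ hc2).2, add_assoc, add_comm 1]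
  iterate 34 (refine Reach.step rfl ?_; simp [Instr.exec, one, m0, m1, m2, m3])
  -- Only the header of the value array enters the heap. The free pointer then skips its `ts.length
  -- + 1` pending cells, and the entry block is allocated above them. The array of terms is shared
  -- with the original tuple.
  have e₁ := coh.ext_alloc [ts.length + 1]
  have coh₁ := (coh.alloc [ts.length + 1]).mono (Nat.le_add_right _ (ts.length + 1))
  have e₂ := coh₁.ext_alloc [3, reg 3, q, ts.length, reg 1]
  have e := e₁.trans (e₂.anti (by simp; omega))
  refine Reach.done (.inl ⟨_, _, Step.csea3 .., rfl, _,
    coh₁.alloc [3, reg 3, q, ts.length, reg 1], by simp, one, ⟨h2, Term.Rep.mono e _ _ ht⟩,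
    ⟨b, ?_, hA.mono (e.anti hS.le) le_rfl⟩, envl.mono e, envs.mono e⟩)
  refine ⟨by simp, ⟨Heap.alloc_get (i := 0) _ rfl, ⟨q, Heap.alloc_get (i := 2) _ rfl,
    Term.Reps.mono e _ _ hts⟩, Heap.alloc_get (i := 3) _ rfl, reg 1,
    Heap.alloc_get (i := 4) _ rfl, ?_, trivial⟩, reg 3, Heap.alloc_get (i := 1) _ rfl, reg 1,
    ⟨reg 1, Heap.alloc_get (i := 4) _ rfl, le_rfl, by simp; omega, ?_⟩, hS.mono e le_rfl⟩
  · exact e₂.1 _ _ (Heap.alloc_get (i := 0) _ rfl)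
  · intro i hi
    rw [Heap.alloc_of_lt _ (by simp; omega)]
    exact (coh.alloc [ts.length + 1]).none (by simp)

theorem reach_pvar {reg mem : ℕ → ℕ} {h : Heap} {p : PVar} {S : List Entry} {E : Env}
    {A : List (List Entry × Env)} (H : Config.Inv ⟨121, reg, mem⟩ h ⟨.code (.pvar p), S, E, A⟩) :
    Reach machine ⟨121, reg, mem⟩ 40 (Outcome ⟨.code (.pvar p), S, E, A⟩) := by
  have H' := H
  obtain ⟨coh, pos, one, ⟨h2, hc, hc1⟩, st, envl, envs⟩ := H
  dsimp only at *
  have m0 := (coh _ _ hc).2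
  have m1 := (coh _ _ hc1).2
  have ml := (coh _ _ envl.1).2
  have ms := (coh _ _ envs.1).2
  obtain ⟨x, k⟩ := p
  cases x
  · dsimp only at m0 m1
    -- The machine tests whether the truncated difference of length and index is zero, which holds
    -- exactly when the look-up is undefined.
    by_cases hk : k < E.l.length
    · have hv := List.getElem?_eq_getElem hk
      obtain ⟨c, hc2, hR⟩ := EVal.Reps.get envl.2 hv
      have m2 := (coh _ _ hc2).2
      iterate 13
        refine Reach.step rfl ?_
        simp [Instr.exec, one, m0, m1, ml, Nat.sub_ne_zero_of_lt hk, m2]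
      exact Reach.done (.inl ⟨_, _, Step.csubv _ _ _ _ _ hv, rfl, _, coh, pos, one, ⟨rfl, hR⟩, st,
        envl, envs⟩)
    · iterate 8
        refine Reach.step rfl ?_
        simp [Instr.exec, one, m0, m1, ml, Nat.not_lt.1 hk]
      exact Reach.done (.inr ⟨rfl, fun _ _ st => by cases st; simp_all [Env.lookup],
        H'.represents coh rfl rfl rfl rfl rfl rfl⟩)
  · dsimp only at m0 m1
    by_cases hk : k < E.s.length
    · have hv := List.getElem?_eq_getElem hk
      obtain ⟨c, hc2, hR⟩ := EVal.Reps.get envs.2 hv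
      have m2 := (coh _ _ hc2).2
      iterate 16
        refine Reach.step rfl ?_
        simp [Instr.exec, one, m0, m1, ms, Nat.sub_ne_zero_of_lt hk, m2]
      exact Reach.done (.inl ⟨_, _, Step.csubv _ _ _ _ _ hv, rfl, _, coh, pos, one, ⟨rfl, hR⟩, st,
        envl, envs⟩)
    · iterate 11
        refine Reach.step rfl ?_
        simp [Instr.exec, one, m0, m1, ms, Nat.not_lt.1 hk]
      exact Reach.done (.inr ⟨rfl, fun _ _ st => by cases st; simp_all [Env.lookup],
        H'.represents coh rfl rfl rfl rfl rfl rfl⟩)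

/-! ### Transitions from values -/

theorem reach_nil {reg mem : ℕ → ℕ} {h : Heap} {v : EVal} {E : Env}
    {A : List (List Entry × Env)} (H : Config.Inv ⟨6, reg, mem⟩ h ⟨.val v, [], E, A⟩) :
    Reach machine ⟨6, reg, mem⟩ 40 (Outcome ⟨.val v, [], E, A⟩) := by
  have H' := H
  obtain ⟨coh, pos, one, focus, ⟨b, hS, hA⟩, envl, envs⟩ := H
  dsimp only at *
  have h3 : reg 3 = 0 := hS.1
  cases A with
  | nil =>
    have h6 : reg 6 = 0 := hA
    iterate 2 (refine Reach.step rfl ?_; simp [Instr.exec, h3, h6])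
    exact Reach.done (.inr ⟨rfl, fun _ _ st => (by cases st),
      H'.represents coh rfl rfl rfl rfl rfl rfl⟩)
  | cons x A =>
    obtain ⟨S, E'⟩ := x
    obtain ⟨h0, c, h1, q, h2, hl, q', h4, hs, a', h6, d, hS', hA⟩ := hA
    have m1 := (coh _ _ h1).2
    have m2 := (coh _ _ h2).2
    have m4 := (coh _ _ h4).2
    have m6 := (coh _ _ h6).2
    iterate 10 (refine Reach.step rfl ?_; simp [Instr.exec, one, h3, m1, m2, m4, m6, h0])
    exact Reach.done (.inl ⟨_, _, Step.bsea7 .., rfl, h, coh, pos, one, focus,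
      ⟨d, hS'.mono (.refl _ _) hS.2, hA⟩, hl, hs⟩)

theorem reach_code {reg mem : ℕ → ℕ} {h : Heap} {v : EVal} {t : Term} {S : List Entry} {E : Env}
    {A : List (List Entry × Env)} (H : Config.Inv ⟨6, reg, mem⟩ h ⟨.val v, .code t :: S, E, A⟩) :
    Reach machine ⟨6, reg, mem⟩ 40 (Outcome ⟨.val v, .code t :: S, E, A⟩) := by
  obtain ⟨coh, pos, one, ⟨_, hv⟩,
    ⟨b, ⟨h3, ⟨hc, c, hc2, ht⟩, r, hc1, d, hd, hS⟩, hA⟩, envl, envs⟩ := H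
  dsimp only at *
  have m0 := (coh _ _ hc).2
  have m1 := (coh _ _ hc1).2
  have m2 := (coh _ _ hc2).2
  iterate 17 (refine Reach.step rfl ?_; simp [Instr.exec, one, h3, m0, m1, m2])
  have e := coh.ext_alloc [1, r, reg 0]
  refine Reach.done (.inl ⟨_, _, Step.bsea1 .., rfl, _, coh.alloc [1, r, reg 0],
    by simp, one, ⟨rfl, Term.Rep.mono e _ _ ht⟩,
    ⟨b, ?_, hA.mono (e.anti (hS.le.trans hd)) le_rfl⟩, envl.mono e, envs.mono e⟩)
  exact ⟨pos.ne', ⟨Heap.alloc_get (i := 0) _ rfl, reg 0, Heap.alloc_get (i := 2) _ rfl,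
    EVal.Rep.mono e _ _ hv⟩, r, Heap.alloc_get (i := 1) _ rfl, d, hd.trans (Nat.le_add_right _ 3),
    hS.mono (e.anti hd) le_rfl⟩

/-- Only a closure facing a tuple fires β; other shapes are final. β copies nothing: the bag and the
argument tuple become the environment by address, and the only allocation is a four-cell frame. -/
theorem reach_val {reg mem : ℕ → ℕ} {h : Heap} {v w : EVal} {S : List Entry} {E : Env}
    {A : List (List Entry × Env)} (H : Config.Inv ⟨6, reg, mem⟩ h ⟨.val v, .val w :: S, E, A⟩) :
    Reach machine ⟨6, reg, mem⟩ 40 (Outcome ⟨.val v, .val w :: S, E, A⟩) := by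
  have H' := H
  obtain ⟨coh, pos, one, ⟨_, hv⟩,
    ⟨b, ⟨h3, ⟨hc, c, hc2, hw⟩, r, hc1, d, hd, hS⟩, hA⟩, envl, envs⟩ := H
  dsimp only at *
  have m0 := (coh _ _ hc).2
  have m1 := (coh _ _ hc1).2
  have m2 := (coh _ _ hc2).2
  cases v with
  | tuple vs =>
    have m3 := (coh _ _ hv.1).2
    iterate 7 (refine Reach.step rfl ?_; simp [Instr.exec, one, h3, m0, m3])
    exact Reach.done (.inr ⟨rfl, fun _ _ st => (by cases st),
      H'.represents coh rfl rfl rfl rfl rfl rfl⟩)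
  | clos t vs =>
    obtain ⟨hv0, ⟨q, hv1, hq⟩, a, hv2, ht⟩ := hv
    have m3 := (coh _ _ hv0).2
    cases w with
    | clos t' vs' =>
      have m4 := (coh _ _ hw.1).2
      iterate 14 (refine Reach.step rfl ?_; simp [Instr.exec, one, h3, m0, m1, m2, m3, m4])
      exact Reach.done (.inr ⟨rfl, fun _ _ st => (by cases st),
        H'.represents coh rfl rfl rfl rfl rfl rfl⟩)
    | tuple ws =>
      obtain ⟨hw0, q', hw1, hq'⟩ := hw
      have m4 := (coh _ _ hw0).2
      have m5 := (coh _ _ hw1).2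
      have m6 := (coh _ _ hv1).2
      have m7 := (coh _ _ hv2).2
      iterate 34
        refine Reach.step rfl ?_
        simp [Instr.exec, one, h3, m0, m1, m2, m3, m4, m5, m6, m7]
      have e := coh.ext_alloc [r, reg 4, reg 5, reg 6]
      exact Reach.done (.inl ⟨_, _, Step.bbeta .., rfl, _, coh.alloc [r, reg 4, reg 5, reg 6],
        by simp, one, ⟨rfl, Term.Rep.mono e _ _ ht⟩,
        ⟨reg 1, ⟨rfl, Nat.le_add_right _ 4⟩, pos.ne', r, Heap.alloc_get (i := 0) _ rfl, reg 4,
          Heap.alloc_get (i := 1) _ rfl, envl.mono e, reg 5, Heap.alloc_get (i := 2) _ rfl,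
          envs.mono e, reg 6, Heap.alloc_get (i := 3) _ rfl, b, hS.mono (e.anti hd) hd,
          hA.mono (e.anti (hS.le.trans hd)) le_rfl⟩,
        arrayRep.mono e hq, arrayRep.mono e hq'⟩)

theorem reach_projEntry {reg mem : ℕ → ℕ} {h : Heap} {v : EVal} {k : ℕ} {S : List Entry} {E : Env}
    {A : List (List Entry × Env)} (H : Config.Inv ⟨6, reg, mem⟩ h ⟨.val v, .proj k :: S, E, A⟩) :
    Reach machine ⟨6, reg, mem⟩ 40 (Outcome ⟨.val v, .proj k :: S, E, A⟩) := by
  have H' := H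
  obtain ⟨coh, pos, one, ⟨h2, hv⟩,
    ⟨b, ⟨h3, ⟨hc, hc2⟩, r, hc1, d, hd, hS⟩, hA⟩, envl, envs⟩ := H
  dsimp only at *
  have m0 := (coh _ _ hc).2
  have m1 := (coh _ _ hc1).2
  have m2 := (coh _ _ hc2).2
  cases v with
  | clos t vs =>
    have m3 := (coh _ _ hv.1).2
    iterate 10 (refine Reach.step rfl ?_; simp [Instr.exec, one, h3, m0, m3])
    exact Reach.done (.inr ⟨rfl, fun _ _ st => (by cases st),
      H'.represents coh rfl rfl rfl rfl rfl rfl⟩)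
  | tuple vs =>
    obtain ⟨hv0, q, hv1, hq, hvs⟩ := hv
    have m3 := (coh _ _ hv0).2
    have m4 := (coh _ _ hv1).2
    have m5 := (coh _ _ hq).2
    by_cases hk : k < vs.length
    · have hv := List.getElem?_eq_getElem hk
      obtain ⟨c, hc3, hR⟩ := EVal.Reps.get hvs hv
      have m6 := (coh _ _ hc3).2
      iterate 23
        refine Reach.step rfl ?_
        simp [Instr.exec, one, h3, m0, m1, m2, m3, m4, m5, Nat.sub_ne_zero_of_lt hk, m6]
      exact Reach.done (.inl ⟨_, _, Step.bpi _ _ _ _ _ _ hv, rfl, _, coh, pos, one, ⟨h2, hR⟩,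
        ⟨b, hS.mono (.refl _ _) hd, hA⟩, envl, envs⟩)
    · iterate 18
        refine Reach.step rfl ?_
        simp [Instr.exec, one, h3, m0, m1, m2, m3, m4, m5, Nat.not_lt.1 hk]
      exact Reach.done (.inr ⟨rfl, fun _ _ st => by cases st; simp_all,
        H'.represents coh rfl rfl rfl rfl rfl rfl⟩)

theorem reach_tup_nil {reg mem : ℕ → ℕ} {h : Heap} {v : EVal} {vs : List EVal} {S : List Entry}
    {E : Env} {A : List (List Entry × Env)}
    (H : Config.Inv ⟨6, reg, mem⟩ h ⟨.val v, .tup [] vs :: S, E, A⟩) :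
    Reach machine ⟨6, reg, mem⟩ 40 (Outcome ⟨.val v, .tup [] vs :: S, E, A⟩) := by
  obtain ⟨coh, pos, one, ⟨h2, hv⟩, ⟨b, ⟨h3, ⟨hc, ⟨p, hc2, -⟩, hc3, q, hc4, hq, hvs⟩, r, hc1, d,
    ⟨q', hc4', hdq, hqb, hpend⟩, hS⟩, hA⟩, envl, envs⟩ := H
  dsimp only at *
  obtain rfl : q = q' := Option.some.inj (hc4.symm.trans hc4')
  have m0 := (coh _ _ hc).2
  have m1 := (coh _ _ hc1).2
  have m2 := (coh _ _ hc2).2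
  have m3 : mem (reg 3 + 3) = 0 := (coh _ _ hc3).2
  have m4 := (coh _ _ hc4).2
  iterate 26 (refine Reach.step rfl ?_; simp [Instr.exec, one, h3, m0, m1, m2, m3, m4])
  -- The write goes to the last pending cell, below the free pointer. It is an extension with bound
  -- `q + 1`, above everything reserved for the rest of the stack, and the completed array becomes
  -- that of the tuple value.
  have hn : h (q + 1) = none := hpend 0 (Nat.zero_le _)
  have hqb : q + 1 < reg 1 := hqb
  have coh₁ := coh.update (reg 0) hqb
  have e₁ := Heap.Ext.update (b := q + 1) (reg 0) le_rfl hn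
  have e₂ := coh₁.ext_alloc [0, q]
  have e := e₁.trans (e₂.anti hqb.le)
  exact Reach.done (.inl ⟨_, _, Step.bsea3 .., rfl, _, coh₁.alloc [0, q], by simp, one,
    ⟨h2, Heap.alloc_get (i := 0) _ rfl, q, Heap.alloc_get (i := 1) _ rfl,
      by simpa [add_comm] using e.1 _ _ hq,
      ⟨reg 0, e₂.1 _ _ (by simp), EVal.Rep.mono e _ _ hv⟩, EVal.Reps.mono e _ _ hvs⟩,
    ⟨b, hS.mono (e.anti (by omega)) (by simp; omega),
      hA.mono (e.anti (by have := hS.le; omega)) le_rfl⟩,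
    envl.mono e, envs.mono e⟩)

theorem reach_tup_append {reg mem : ℕ → ℕ} {h : Heap} {v : EVal} {ts : List Term} {t : Term}
    {vs : List EVal} {S : List Entry} {E : Env} {A : List (List Entry × Env)}
    (H : Config.Inv ⟨6, reg, mem⟩ h ⟨.val v, .tup (ts ++ [t]) vs :: S, E, A⟩) :
    Reach machine ⟨6, reg, mem⟩ 40 (Outcome ⟨.val v, .tup (ts ++ [t]) vs :: S, E, A⟩) := by
  obtain ⟨coh, pos, one, ⟨h2, hv⟩, ⟨b, ⟨h3, ⟨hc, ⟨p, hc2, hts⟩, hc3, q, hc4, hq, hvs⟩, r, hc1, d,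
    ⟨q', hc4', hdq, hqb, hpend⟩, hS⟩, hA⟩, envl, envs⟩ := H
  dsimp only at *
  obtain rfl : q = q' := Option.some.inj (hc4.symm.trans hc4')
  rw [Term.Reps.append] at hts
  obtain ⟨hts, ⟨c, hc5, ht⟩, -⟩ := hts
  rw [List.length_append, List.length_singleton] at hc3 hq hvs hqb hpend
  have m0 := (coh _ _ hc).2
  have m1 := (coh _ _ hc1).2
  have m2 := (coh _ _ hc2).2
  have m3 := (coh _ _ hc3).2
  have m4 := (coh _ _ hc4).2
  have m5 : mem (p + (ts.length + 1)) = c := by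
    rw [← (coh _ _ hc5).2, add_assoc, add_comm 1]
  iterate 37 (refine Reach.step rfl ?_; simp [Instr.exec, one, h3, m0, m1, m2, m3, m4, m5])
  have hn := hpend _ le_rfl
  have hqb' : q + 1 + (ts.length + 1) < reg 1 := by omega
  have coh₁ := coh.update (reg 0) hqb'
  -- The highest pending cell is filled; with its address as bound, the lower ones stay undefined
  -- and are inherited by the new entry, which shares the array.
  have e₁ := Heap.Ext.update (b := q + 1 + (ts.length + 1)) (reg 0) le_rfl hn
  have e₂ := coh₁.ext_alloc [3, r, p, ts.length, q]
  have e := e₁.trans (e₂.anti hqb'.le)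
  refine Reach.done (.inl ⟨_, _, Step.bsea6 .., rfl, _, coh₁.alloc [3, r, p, ts.length, q],
    by simp, one, ⟨rfl, Term.Rep.mono e _ _ ht⟩,
    ⟨b, ?_, hA.mono (e.anti (by have := hS.le; omega)) le_rfl⟩, envl.mono e, envs.mono e⟩)
  refine ⟨pos.ne', ⟨Heap.alloc_get (i := 0) _ rfl, ⟨p, Heap.alloc_get (i := 2) _ rfl,
    Term.Reps.mono e _ _ hts⟩, Heap.alloc_get (i := 3) _ rfl, q,
    Heap.alloc_get (i := 4) _ rfl, ?_, ⟨reg 0, e₂.1 _ _ (Function.update_self ..),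
      EVal.Rep.mono e _ _ hv⟩, EVal.Reps.mono e _ _ hvs⟩, r, Heap.alloc_get (i := 1) _ rfl, d,
    ⟨q, Heap.alloc_get (i := 4) _ rfl, hdq, by simp; omega, ?_⟩, hS.mono (e.anti (by omega)) le_rfl⟩
  · rw [e.1 _ _ hq, List.length_cons]
    congr 1
    omega
  · intro i hi
    exact e.2 _ (by omega) (hpend i (by omega))

/-! ### Closures -/

/-- The registers which are not modified by the loop over bags have the same content. -/
def SameRegs (reg reg' : ℕ → ℕ) : Prop := ∀ r, r < 9 ∨ r = 10 ∨ r = 12 → reg' r = reg r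

theorem SameRegs.update {reg reg' : ℕ → ℕ} (H : SameRegs reg reg') {d : ℕ} (v : ℕ)
    (hd : 9 ≤ d ∧ d ≠ 10 ∧ d ≠ 12) : SameRegs reg (Function.update reg' d v) := by
  intro r hr
  rw [Function.update_of_ne (by omega), H r hr]

/-- The two outcomes are continuations, so that iterations chain by induction and their times add
up. The 19 is the length of an iteration for a source variable. -/
theorem reach_bag_step {reg mem : ℕ → ℕ} {h : Heap} {b c m : ℕ} {E : Env} {p : PVar}
    {Q : Config → Prop} (coh : h.Coh mem b) (one : reg 7 = 1)
    (envl : arrayRep h (reg 4) E.l) (envs : arrayRep h (reg 5) E.s)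
    (h11 : reg 11 ≠ 0) (hc : h (reg 9) = some c) (hp : Term.Rep h c (.pvar p))
    (found : ∀ v a reg', E.lookup p = some v → EVal.Rep h a v → SameRegs reg reg' →
      reg' 9 = reg 9 + 1 → reg' 11 = reg 11 - 1 → reg' 13 = reg 13 + 1 →
      Reach machine ⟨142, reg', Function.update mem (reg 13) a⟩ m Q)
    (missing : ∀ reg', E.lookup p = none → SameRegs reg reg' → Q ⟨218, reg', mem⟩) :
    Reach machine ⟨142, reg, mem⟩ (m + 19) Q := by
  obtain ⟨x, k⟩ := p
  obtain ⟨hp0, hp1⟩ := hp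
  have m0 := (coh _ _ hc).2
  have m1 := (coh _ _ hp0).2
  have m2 := (coh _ _ hp1).2
  have ml := (coh _ _ envl.1).2
  have ms := (coh _ _ envs.1).2
  have frame : SameRegs reg reg := fun _ _ => rfl
  cases x
  · dsimp only at m1 m2
    by_cases hk : k < E.l.length
    · have hv := List.getElem?_eq_getElem hk
      obtain ⟨a, hc2, hR⟩ := EVal.Reps.get envl.2 hv
      have m3 := (coh _ _ hc2).2
      iterate 18
        refine Reach.step rfl ?_
        simp [Instr.exec, one, h11, m0, m1, m2, ml, Nat.sub_ne_zero_of_lt hk, m3]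
      -- A wrapped variable takes one instruction less, as it needs no jump over the other branch.
      refine (found _ a _ hv hR ?_ ?_ ?_ ?_).mono (Nat.le_succ _)
      · repeat refine SameRegs.update ?_ _ (by decide)
        exact frame
      all_goals simp
    · iterate 10
        refine Reach.step rfl ?_
        simp [Instr.exec, one, h11, m0, m1, m2, ml, Nat.not_lt.1 hk]
      refine Reach.done (missing _ (List.getElem?_eq_none (Nat.not_lt.1 hk)) ?_)
      repeat refine SameRegs.update ?_ _ (by decide)
      exact frame
  · dsimp only at m1 m2
    by_cases hk : k < E.s.length
    · have hv := List.getElem?_eq_getElem hk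
      obtain ⟨a, hc2, hR⟩ := EVal.Reps.get envs.2 hv
      have m3 := (coh _ _ hc2).2
      iterate 19
        refine Reach.step rfl ?_
        simp [Instr.exec, one, h11, m0, m1, m2, ms, Nat.sub_ne_zero_of_lt hk, m3]
      refine found _ a _ hv hR ?_ ?_ ?_ ?_
      · repeat refine SameRegs.update ?_ _ (by decide)
        exact frame
      all_goals simp
    · iterate 11
        refine Reach.step rfl ?_
        simp [Instr.exec, one, h11, m0, m1, m2, ms, Nat.not_lt.1 hk]
      refine Reach.done (missing _ (List.getElem?_eq_none (Nat.not_lt.1 hk)) ?_)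
      repeat refine SameRegs.update ?_ _ (by decide)
      exact frame

/-- During the loop register 13 is the effective free pointer, while register 1 still marks the
start of the new array. If a look-up fails, the cells written so far can be forgotten and the
original heap still agrees with the memory. -/
theorem reach_bag {E : Env} {m : ℕ} {Q : Config → Prop} (ps : List PVar) {reg mem : ℕ → ℕ}
    {h : Heap} (coh : h.Coh mem (reg 13)) (one : reg 7 = 1)
    (envl : arrayRep h (reg 4) E.l) (envs : arrayRep h (reg 5) E.s)
    (h11 : reg 11 = ps.length) (hps : Term.Reps h (reg 9) (ps.map Term.pvar))
    (found : ∀ vs h' reg' mem', List.Forall₂ (fun p v => E.lookup p = some v) ps vs →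
      SameRegs reg reg' → h'.Coh mem' (reg' 13) → Heap.Ext (reg 13) h h' →
      reg 13 ≤ reg' 13 → EVal.Reps h' (reg 13) vs → Reach machine ⟨162, reg', mem'⟩ m Q)
    (missing : ∀ reg' mem' b, SameRegs reg reg' → h.Coh mem' b →
      (∀ vs, ¬ List.Forall₂ (fun p v => E.lookup p = some v) ps vs) → Q ⟨218, reg', mem'⟩) :
    Reach machine ⟨142, reg, mem⟩ (m + 19 * ps.length + 1) Q := by
  induction ps generalizing reg mem h with
  | nil =>
    have h11 : reg 11 = 0 := h11
    refine Reach.step rfl ?_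
    simp [Instr.exec, h11]
    exact found [] h reg mem .nil (fun _ _ => rfl) coh (.refl _ _) le_rfl trivial
  | cons p ps ih =>
    obtain ⟨⟨c, hc, hp⟩, hps⟩ := hps
    have := reach_bag_step (m := m + 19 * ps.length + 1) (Q := Q) coh one envl envs
      (by simp [h11]) hc hp ?_ ?_
    · exact this.mono (by simp only [List.length_cons]; omega)
    · intro v a reg₁ hv hR same h9' h11' h13'
      have e₁ := Heap.Ext.update (b := reg 13) a le_rfl (coh.none le_rfl)
      have coh₁ := (coh.mono (Nat.le_succ _)).update a (Nat.lt_succ_self _)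
      refine ih (h := Function.update h (reg 13) (some a)) ?_ ?_ ?_ ?_ ?_ ?_ ?_ ?_
      · rw [h13']; exact coh₁
      · rw [same 7 (by decide), one]
      · rw [same 4 (by decide)]; exact envl.mono e₁
      · rw [same 5 (by decide)]; exact envs.mono e₁
      · rw [h11', h11]; rfl
      · rw [h9']; exact Term.Reps.mono e₁ _ _ hps
      · intro vs h' reg' mem' hvs same' coh' e' le hR'
        rw [h13'] at e' le hR'
        have e := e₁.trans (e'.anti (Nat.le_succ _))
        exact found (v :: vs) h' reg' mem' (.cons hv hvs)
          (fun r hr => (same' r hr).trans (same r hr)) coh' e (by omega)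
          ⟨⟨a, e'.1 _ _ (Function.update_self ..), EVal.Rep.mono e _ _ hR⟩, hR'⟩
      · intro reg' mem' b same' coh' hvs
        refine missing reg' mem' b (fun r hr => (same' r hr).trans (same r hr)) (coh'.of_ext e₁) ?_
        intro vs H
        cases H with
        | cons _ H => exact hvs _ H
    · intro reg' hv same
      refine missing reg' mem _ same coh ?_
      intro vs H
      cases H with
      | cons H _ => simp [hv] at H

theorem reach_clos {reg mem : ℕ → ℕ} {h : Heap} {n m : ℕ} {t : Term} {ps : List PVar}
    {S : List Entry} {E : Env} {A : List (List Entry × Env)}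
    (H : Config.Inv ⟨121, reg, mem⟩ h ⟨.code (.clos n m t (ps.map Term.pvar)), S, E, A⟩) :
    Reach machine ⟨121, reg, mem⟩ (40 * (ps.length + 1))
      (Outcome ⟨.code (.clos n m t (ps.map Term.pvar)), S, E, A⟩) := by
  have H' := H
  obtain ⟨coh, pos, one, ⟨h2, hc, hc1, hc2, ⟨c, hc3, ht⟩, q, hc4, hq, hps⟩, ⟨b, hS, hA⟩, envl,
    envs⟩ := H
  dsimp only at *
  rw [List.length_map] at hq
  have m0 := (coh _ _ hc).2
  have m3 := (coh _ _ hc3).2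
  have m4 := (coh _ _ hc4).2
  have m5 := (coh _ _ hq).2
  -- 21 instructions before the loop, 19 per variable, 1 to leave the loop, and 9 to build the
  -- closure.
  suffices Reach machine ⟨121, reg, mem⟩ (9 + 19 * ps.length + 1 + 21) _ from
    this.mono (by omega)
  iterate 21
    refine Reach.step rfl ?_
    simp [Instr.exec, one, m0, m3, m4, m5]
  have coh₁ := coh.alloc [ps.length]
  have e₁ := coh.ext_alloc [ps.length]
  refine reach_bag (E := E) (m := 9) ps (h := h.alloc (reg 1) [ps.length]) ?_ ?_ ?_ ?_ ?_ ?_ ?_ ?_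
  · simpa [writes] using coh₁
  · simpa using one
  · simpa using envl.mono e₁
  · simpa using envs.mono e₁
  · simp
  · simpa using Term.Reps.mono e₁ _ _ hps
  · intro vs h₂ reg' mem' hvs same coh₂ e₂ le hR
    simp at e₂ le hR
    have s1 := same 1 (by decide)
    have s3 := same 3 (by decide)
    have s4 := same 4 (by decide)
    have s5 := same 5 (by decide)
    have s6 := same 6 (by decide)
    have s7 := same 7 (by decide)
    have s10 := same 10 (by decide)
    have s12 := same 12 (by decide)
    simp at s1 s3 s4 s5 s6 s7 s10 s12
    rw [one] at s7
    iterate 9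
      refine Reach.step rfl ?_
      simp [Instr.exec, s7, s10, s12]
    have e₃ := coh₂.ext_alloc [1, reg 1, c]
    have e₂₃ := (e₂.anti (Nat.le_succ _)).trans (e₃.anti (by omega : reg 1 ≤ reg' 13))
    have e := e₁.trans e₂₃
    refine Reach.done (.inl ⟨_, _, Step.csubw _ _ _ _ vs _ _ _ hvs, rfl, _,
      coh₂.alloc [1, reg 1, c], by simp, s7, ⟨rfl, Heap.alloc_get (i := 0) _ rfl,
      ⟨reg 1, Heap.alloc_get (i := 1) _ rfl, ?_, EVal.Reps.mono e₃ _ _ hR⟩, c,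
      Heap.alloc_get (i := 2) _ rfl, Term.Rep.mono e _ _ ht⟩, ⟨b, ?_, ?_⟩, ?_, ?_⟩)
    · rw [← hvs.length_eq]
      exact e₂₃.1 _ _ (Heap.alloc_get (i := 0) _ rfl)
    · simpa [s3] using hS.mono e (by omega : reg 1 ≤ reg' 13 + 3)
    · simpa [s6] using hA.mono (e.anti hS.le) le_rfl
    · simpa [s4] using envl.mono e
    · simpa [s5] using envs.mono e
  · intro reg' mem' b same coh' hvs
    refine Or.inr ⟨rfl, ?_, H'.represents (coh'.of_ext e₁) ?_ ?_ ?_ ?_ ?_ ?_⟩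
    · intro _ _ st
      -- The bag must be a variable for `cases` to unify it with the mapped list in the rule.
      generalize hb : ps.map Term.pvar = bag at st
      cases st
      obtain rfl := map_pvar_injective hb
      exact hvs _ ‹_›
    all_goals
      dsimp only
      rw [same _ (by decide)]
      simp

/-! ### Runs -/

/-- The 41 is the uniform 40 plus the initial test of the flag. Primeness is needed for closures, as
the loop reads bag elements as projected variables. Positivity of `k` makes the times strictly
increasing. -/
theorem reach_outcome {c : Config} {h : Heap} {s : State} {M : ℕ} (H : c.Inv h s) (hpc : c.pc = 5)
    (ok : s.OK M) :
    ∃ k c', 0 < k ∧ k ≤ 41 * (s.width + 1) ∧ ramExec machine c k = some c' ∧ Outcome s c' := by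
  obtain ⟨pc, reg, mem⟩ := c
  obtain rfl : pc = 5 := hpc
  suffices Reach machine ⟨if reg 2 = 0 then 121 else 6, reg, mem⟩ (40 * (s.width + 1))
      (Outcome s) by
    obtain ⟨k, hk, c', h, hQ⟩ := this
    refine ⟨1 + k, c', by omega, by omega, ?_, hQ⟩
    rw [ramExec_add]
    exact h
  obtain ⟨f, S, E, A⟩ := s
  cases f with
  | code t =>
    have h2 : reg 2 = 0 := H.focus.1
    rw [if_pos h2]
    have H' : Config.Inv ⟨121, reg, mem⟩ h ⟨.code t, S, E, A⟩ := { H with }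
    cases t with
    | pvar p => exact reach_pvar H'
    | proj k t => exact reach_proj H'
    | app t u => exact reach_app H'
    | tuple ts =>
      rcases List.eq_nil_or_concat ts with rfl | ⟨ts, t, rfl⟩
      · exact reach_tuple_nil H'
      · rw [List.concat_eq_append] at *
        exact (reach_tuple_append H').mono (Nat.le_mul_of_pos_right 40 (Nat.succ_pos _))
    | clos n m t b =>
      obtain ⟨_, ps, rfl⟩ := ok.focus.1.bag
      simpa [State.width] using reach_clos H'
  | val v =>
    have h2 : reg 2 = 1 := H.focus.1
    rw [if_neg (by omega)]
    have H' : Config.Inv ⟨6, reg, mem⟩ h ⟨.val v, S, E, A⟩ := { H with }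
    cases S with
    | nil => exact reach_nil H'
    | cons x S =>
      cases x with
      | code t => exact reach_code H'
      | val w => exact reach_val H'
      | proj k => exact reach_projEntry H'
      | tup ts vs =>
        rcases List.eq_nil_or_concat ts with rfl | ⟨ts, t, rfl⟩
        · exact reach_tup_nil H'
        · rw [List.concat_eq_append] at *
          exact reach_tup_append H'

theorem reach_init {c : Config} {t : Term} (H : c.IsInput t) :
    ∃ c', ramExec machine c 5 = some c' ∧ c'.pc = 5 ∧ ∃ h, c'.Inv h (State.init t) := by
  obtain ⟨pc, reg, mem⟩ := c
  obtain ⟨hpc, hr, ht⟩ := H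
  dsimp only at *
  subst hpc
  set h : Heap := fun a => if a < reg 1 then some (mem a) else none with hh
  have coh : h.Coh mem (reg 1) := by
    intro x v e
    simp only [hh] at e
    split_ifs at e with l
    exact ⟨l, by simpa using e⟩
  -- Address 0 denotes the empty stack, so allocated blocks must avoid it; any representation of `t`
  -- already occupies a cell below register 1.
  have pos : 0 < reg 1 := by
    by_contra hp
    have hn : ∀ a, h a = none := fun a => if_neg (by omega)
    cases t <;> simp [Term.Rep, hn] at ht
  -- One cell holding 0 serves as the empty array for both components of the initial environment.
  have e := coh.ext_alloc [0]
  have hnil : arrayRep (h.alloc (reg 1) [0]) (reg 1) [] :=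
    ⟨Heap.alloc_get (i := 0) _ rfl, trivial⟩
  refine ⟨_, rfl, rfl, h.alloc (reg 1) [0], ?_, Nat.succ_pos _, rfl, ?_, ⟨0, ?_, ?_⟩, ?_, ?_⟩
  all_goals simp [Instr.exec, State.init, hr]
  · exact coh.alloc [0]
  · exact ⟨rfl, Term.Rep.mono e _ _ ht⟩
  · exact ⟨rfl, Nat.zero_le _⟩
  · rfl
  · exact hnil
  · exact hnil

-- Summing costs along a run and assembling the times.

theorem Run.ok {ρ : Run} {M : ℕ} (h : (ρ.state 0).OK M) : ∀ j ≤ ρ.len, (ρ.state j).OK M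
  | 0, _ => h
  | j + 1, hj => (Run.ok h j (by omega)).step (ρ.valid j hj)

/-- The number of `β`-transitions among the first `j` transitions. -/
def Run.betaCountBelow (ρ : Run) (j : ℕ) : ℕ :=
  ((Finset.range j).filter (fun i => ρ.label i = Label.bbeta)).card

theorem Run.betaCountBelow_succ (ρ : Run) (j : ℕ) : ρ.betaCountBelow (j + 1) =
    ρ.betaCountBelow j + if ρ.label j = Label.bbeta then 1 else 0 := by
  unfold Run.betaCountBelow
  rw [Finset.range_add_one, Finset.filter_insert]
  split_ifs
  · rw [Finset.card_insert_of_notMem (by simp)]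
  · rfl

theorem Run.sum_width_le {ρ : Run} {M : ℕ} (h : (ρ.state 0).OK M) : ∀ j ≤ ρ.len,
    ∑ i ∈ Finset.range j, ((ρ.state i).width + 1) + (ρ.state j).potential ≤
      (ρ.state 0).potential + (3 * M + 3) * ρ.betaCountBelow j
  | 0, _ => by simp
  | j + 1, hj => by
    have ih := Run.sum_width_le h j (by omega)
    have st := (ρ.valid j hj).potential_le (Run.ok h j (by omega))
    rw [Finset.sum_range_succ, Run.betaCountBelow_succ]
    split_ifs at st ⊢ <;> rw [mul_add] <;> omega

/-- The times are built one transition at a time: halting is excluded because the run goes on, and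
determinism forces the machine's transition to reach the next state of the run. -/
theorem Run.exists_times {ρ : Run} {M : ℕ} (h : (ρ.state 0).OK M) {c₀ c : Config}
    (h₀ : ramExec machine c₀ 5 = some c) (hpc : c.pc = 5)
    (hI : ∃ h, c.Inv h (ρ.state 0)) : ∀ n ≤ ρ.len, ∃ τ : ℕ → ℕ, τ 0 = 5 ∧
      (∀ j < n, τ j < τ (j + 1) ∧ τ (j + 1) ≤ τ j + 41 * ((ρ.state j).width + 1)) ∧
      ∀ j ≤ n, ∃ c, ramExec machine c₀ (τ j) = some c ∧ c.pc = 5 ∧ ∃ h, c.Inv h (ρ.state j) := by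
  intro n hn
  induction n with
  | zero => exact ⟨fun _ => 5, rfl, by simp, fun j hj => by
      obtain rfl : j = 0 := by omega
      exact ⟨c, h₀, hpc, hI⟩⟩
  | succ n ih =>
    obtain ⟨τ, τ0, hτ, hc⟩ := ih (by omega)
    obtain ⟨c₁, hc₁, hpc₁, h₁, hI₁⟩ := hc n le_rfl
    obtain ⟨k, c₂, hk0, hk, hc₂, hO⟩ := reach_outcome hI₁ hpc₁ (Run.ok h n (by omega))
    have st := ρ.valid n hn
    rcases hO with ⟨a, s', st', hpc₂, hI₂⟩ | ⟨_, hF, _⟩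
    · obtain rfl := st.deterministic st' rfl
      refine ⟨fun j => if j ≤ n then τ j else τ n + k, by simpa using τ0, ?_, ?_⟩
      · intro j hj
        rcases Nat.lt_succ_iff_lt_or_eq.1 hj with hj | rfl
        · simpa [hj.le, Nat.succ_le_of_lt hj] using hτ j hj
        · simpa using ⟨hk0, hk⟩
      · intro j hj
        rcases Nat.le_succ_iff.1 hj with hj | rfl
        · simpa [hj] using hc j hj
        · refine ⟨c₂, ?_, hpc₂, hI₂⟩
          simp [ramExec_add, hc₁, hc₂]
    · exact (hF _ _ st).elim

theorem Run.time_le {ρ : Run} {τ : ℕ → ℕ} : ∀ n,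
    (∀ j < n, τ j < τ (j + 1) ∧ τ (j + 1) ≤ τ j + 41 * ((ρ.state j).width + 1)) →
      τ n ≤ τ 0 + 41 * ∑ i ∈ Finset.range n, ((ρ.state i).width + 1)
  | 0, _ => by simp
  | n + 1, h => by
    have ih := Run.time_le n fun j hj => h j (by omega)
    have := (h n (by omega)).2
    rw [Finset.sum_range_succ]
    omega

end TargetTAM

open TargetTAM in
theorem mainTheorem9 :
    ∃ (P : List TargetTAM.Instr) (C : ℕ),
      ∀ t : TargetTAM.Term, t.Closed → t.Prime →
      ∀ ρ : TargetTAM.Run, ρ.state 0 = TargetTAM.State.init t → ρ.Complete →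
        ρ.len ≤ C * ((ρ.betaCount + 1) * max 1 t.size) ∧
        ∀ c₀ : TargetTAM.Config, c₀.IsInput t →
          ∃ T : ℕ, T ≤ C * ((ρ.betaCount + 1) * max 1 t.size) ∧
            TargetTAM.Implements P C ρ c₀ T := by
  -- With B the bilinear bound, the total is at most 5 + 41·6B for the start and the transitions,
  -- plus 41(|t| + 1) ≤ 82B for the last attempt, hence at most 333B; 400 is a round choice.
  refine ⟨machine, 400, fun t _ hp ρ h0 hF => ?_⟩
  have ok : (ρ.state 0).OK t.size := h0 ▸ State.OK.init t hp
  have hsum := Run.sum_width_le ok ρ.len le_rfl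
  have hB : ∑ i ∈ Finset.range ρ.len, ((ρ.state i).width + 1) ≤
      6 * ((ρ.betaCount + 1) * max 1 t.size) := by
    have hpot : (ρ.state 0).potential = 3 * t.size + 1 := by
      simp [h0, State.init, State.potential, Focus.potential, cstackPotential]
    have hβ : ρ.betaCountBelow ρ.len = ρ.betaCount := rfl
    rw [hpot, hβ] at hsum
    have h1 : (3 * t.size + 3) * ρ.betaCount ≤ (6 * max 1 t.size) * ρ.betaCount :=
      Nat.mul_le_mul_right _ (by omega)
    have h2 : 6 * ((ρ.betaCount + 1) * max 1 t.size) =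
      (6 * max 1 t.size) * ρ.betaCount + 6 * max 1 t.size := by ring
    omega
  have hlen : ρ.len ≤ ∑ i ∈ Finset.range ρ.len, ((ρ.state i).width + 1) := by
    simp [Finset.sum_add_distrib]
  refine ⟨by omega, fun c₀ hc₀ => ?_⟩
  obtain ⟨c, hc, hpc, hI⟩ := reach_init hc₀
  obtain ⟨τ, τ0, hτ, hcs⟩ := Run.exists_times ok hc hpc (h0 ▸ hI) ρ.len le_rfl
  have hτn := Run.time_le ρ.len hτ
  obtain ⟨c₁, hc₁, hpc₁, h₁, hI₁⟩ := hcs ρ.len le_rfl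
  have okn := Run.ok ok ρ.len le_rfl
  -- On the last state the machine must halt, but it may scan part of a bag before a look-up fails;
  -- this final cost is controlled by `State.OK.width_le`.
  obtain ⟨k, c₂, hk0, hk, hc₂, hO⟩ := reach_outcome hI₁ hpc₁ okn
  rcases hO with ⟨_, _, st, _⟩ | ⟨hpc₂, _, hR⟩
  · exact (hF _ _ st).elim
  have hB1 : max 1 t.size ≤ (ρ.betaCount + 1) * max 1 t.size :=
    Nat.le_mul_of_pos_left _ (Nat.succ_pos _)
  have := okn.width_le
  refine ⟨τ ρ.len + k, by omega, τ, by omega, ?_, ?_, Nat.le_add_right _ _, c₂, ?_, ?_, hR⟩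
  · intro j hj
    have := hτ j hj
    omega
  · intro j hj
    obtain ⟨c, hc, _, h, hI⟩ := hcs j hj
    exact ⟨c, hc, hI.represents hI.coh rfl rfl rfl rfl rfl rfl⟩
  · simp [ramExec_add, hc₁, hc₂]
  · simp only [ramStep, hpc₂]
    rfl
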